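/- Consider prediction with $N\ge 1$ experts and a constant $B>0$. In round $j=1,2,\dots$ the player chooses a probability vector $p_j\in\Delta^{N-1}$, then a loss vector $\ell_j\in\mathbb R^N$ with $\max_{i,i'}|\ell_{j,i}-\ell_{j,i'}|\le B$ is revealed. Put $\Delta x_{j,i}=\langle p_j,\ell_j\rangle-\ell_{j,i}$, $x_0=0$, $x_j=x_{j-1}+\Delta x_j$. For $\epsilon\in(0,1)$ the $\epsilon$-quantile regret $\mathrm{Regret}_\epsilon(T)$ is the $\lfloor N\epsilon\rfloor$-th largest coordinate of $x_T$ (the largest one if $\lfloor N\epsilon\rfloor=0$). Let $\phi(y,t)=t^{-1/2}\exp\!\big(y^2/(2t)\big)$, let $\tilde x_{j,i}=\max\{x_{j,i},0\}$ be the projection onto $\mathbb R_+$, and let $\Phi(x,t)=\sum_{i=1}^N\phi(x_i,t)$. The constant-potential algorithm $\mathsf{CP}(\phi,\mathbb R_+)$ is started at $t_0=\max\{512e^2B^2\log N,\,1\}$ and $V_0=0$. In round $j$ it plays $p_{j,i}\propto\partial_x\phi(\tilde x_{j-1,i},t_{j-1})$ (an arbitrary probability vector if all these derivatives vanish). After the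 losses are revealed it chooses $t_j\ge t_{j-1}$ such that $\Phi(\tilde x_j,t_j)=\Phi(\tilde x_{j-1},t_{j-1})$, and it sets $V_j=V_{j-1}+\sum_i q_{j,i}\,\Delta x_{j,i}^2$, where $q_j\in\Delta^{N-1}$ satisfies $q_{j,i}\propto\partial_{xx}\phi(\tilde x_{j-1,i},t_{j-1})$. Then for every such loss sequence the algorithm can be carried out for all rounds, and, however its choices are made, for all $\epsilon\in(0,1)$ and $T\ge1$, $$\mathrm{Regret}_\epsilon(T)\le\sqrt{(t_0+2V_T)\Big(\log(t_0+2V_T)+2\log\tfrac1\epsilon\Big)}.$$ -/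

import Mathlib

noncomputable section

/-- The instantaneous regrets of one round in which the weights `p` meet the losses `l`. -/
def instRegret {N : ℕ} (p l : Fin N → ℝ) (i : Fin N) : ℝ :=
  (∑ k, p k * l k) - l i

/-- The cumulative regret vector after `j` rounds. Rounds are numbered from `0`, so `p m` and
`ℓ m` belong to the `(m+1)`-st round. -/
def regretVec {N : ℕ} (p ℓ : ℕ → Fin N → ℝ) (j : ℕ) (i : Fin N) : ℝ :=
  ∑ m ∈ Finset.range j, instRegret (p m) (ℓ m) i

/-- The `m`-th largest coordinate of `x` (counted with multiplicity, `1 ≤ m ≤ N`). -/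
def kthLargest {N : ℕ} (x : Fin N → ℝ) (m : ℕ) : ℝ :=
  if h : m - 1 < N then x (Tuple.sort (fun i => -x i) ⟨m - 1, h⟩) else 0

/-- The `ε`-quantile regret: the `⌊N ε⌋`-th largest coordinate of the regret vector
(the largest one if `⌊N ε⌋ = 0`). -/
def quantileRegret {N : ℕ} (ε : ℝ) (x : Fin N → ℝ) : ℝ :=
  kthLargest x (max 1 ⌊(N : ℝ) * ε⌋₊)

/-- The total potential. -/
def totalPotential {N : ℕ} (φ : ℝ → ℝ → ℝ) (x : Fin N → ℝ) (t : ℝ) : ℝ :=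
  ∑ i, φ (x i) t

/-- The first partial derivative of the potential in its space variable. -/
def potDeriv (φ : ℝ → ℝ → ℝ) (y t : ℝ) : ℝ :=
  deriv (fun z => φ z t) y

/-- The second partial derivative of the potential in its space variable. -/
def potDeriv2 (φ : ℝ → ℝ → ℝ) (y t : ℝ) : ℝ :=
  iteratedDeriv 2 (fun z => φ z t) y

/-- `T` rounds of the constant-potential algorithm with potential `φ`, projection `proj` onto
the domain and initial time `t₀`, when the losses are `ℓ`, the weights played are `p`, and `t j`
is the time variable after `j` rounds. -/
structure IsCPRun {N : ℕ} (φ : ℝ → ℝ → ℝ) (proj : ℝ → ℝ) (t₀ : ℝ) (T : ℕ)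
    (ℓ p : ℕ → Fin N → ℝ) (t : ℕ → ℝ) : Prop where
  /-- The initial time. -/
  init : t 0 = t₀
  /-- The weights are probability vectors. -/
  prob : ∀ j < T, p j ∈ stdSimplex ℝ (Fin N)
  /-- The weights are proportional to the derivatives of the potential at the projected regrets.
  If all these derivatives are zero, any probability vector may be played. -/
  prop : ∀ j < T, ∀ i,
    p j i * ∑ k, potDeriv φ (proj (regretVec p ℓ j k)) (t j)
      = potDeriv φ (proj (regretVec p ℓ j i)) (t j)
  /-- The time increments are nonnegative. -/
  mono : ∀ j < T, t j ≤ t (j + 1)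
  /-- The new time keeps the total potential constant. -/
  const : ∀ j < T,
    totalPotential φ (fun i => proj (regretVec p ℓ (j + 1) i)) (t (j + 1))
      = totalPotential φ (fun i => proj (regretVec p ℓ j i)) (t j)

/-- The probability vector `q` proportional to the second derivatives of the potential at the
projected regrets, after `j` rounds. -/
def curvWeight {N : ℕ} (φ : ℝ → ℝ → ℝ) (proj : ℝ → ℝ) (ℓ p : ℕ → Fin N → ℝ) (t : ℕ → ℝ)
    (j : ℕ) (i : Fin N) : ℝ :=
  potDeriv2 φ (proj (regretVec p ℓ j i)) (t j)
    / ∑ k, potDeriv2 φ (proj (regretVec p ℓ j k)) (t j)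

/-- The output `V_T`: the cumulative second moment of the instantaneous regrets under `q`. -/
def cumSecondMoment {N : ℕ} (φ : ℝ → ℝ → ℝ) (proj : ℝ → ℝ) (ℓ p : ℕ → Fin N → ℝ) (t : ℕ → ℝ)
    (T : ℕ) : ℝ :=
  ∑ j ∈ Finset.range T, ∑ i, curvWeight φ proj ℓ p t j i * instRegret (p j) (ℓ j) i ^ 2

/-- The potential `t^{-1/2} exp (y² / (2 t))`. -/
def phiNH (y t : ℝ) : ℝ :=
  t ^ (-(1 / 2) : ℝ) * Real.exp (y ^ 2 / (2 * t))

/-- The projection of the real line onto `[0, ∞)`. -/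
def projNonneg (y : ℝ) : ℝ := max y 0

/-- The initial time `max {512 e² B² log N, 1}`. -/
def startTime (N : ℕ) (B : ℝ) : ℝ :=
  max (512 * Real.exp 1 ^ 2 * B ^ 2 * Real.log N) 1

end

/-! The potential solves the backward heat equation: its time derivative is minus half its second
space derivative. The weights cancel the first-order change of the total potential, so to second
order the time increment that keeps it constant is the `q`-mean of the squared instantaneous
regrets. Hence the second moment `V` nearly tracks `t - t₀`, and the projection only slows the
clock.

Let `s² = t_T / t₀` and let `R ≥ 0` be the `m`-th largest regret. Projected coordinates contribute
at least 1 each to the normalized potential, which equals `N s`. Therefore `exp (R² / (2 t_T)) ≤ 1 +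
(N/m)(s - 1)` (`run_exp_kthLargest_le`). As `N ε < m + 1`, splitting off the factor `N/(m+1)` yields
the `log (1/ε)` term and leaves `X = (m+1)/N + (1 + 1/m)(s - 1)`. With `u = 1 + 2V/t₀`, it remains
to prove `2 s² log X ≤ u log u` (`log_quantile_bound`).

Rounding by the floor can make `X` as large as `2s - 1`, so `u ≥ s²` is too weak. The coarse
estimate `V ≥ (9/10)(t - t₀)` (`run_moment_ge`) suffices unless `N = 2` and `s` is near 1. There
both sides agree to first order in `D = s² - 1`, and `V/t₀ ≥ D - (2/5) D²` is needed
(`run_moment_ge_two`). It comes from a finer remainder estimate (`fine_step`) exploiting the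
orthogonality of the two regrets. -/

noncomputable section

/-! ### Calculus of the potential -/

theorem phiNH_eq {t : ℝ} (ht : 0 < t) (y : ℝ) :
    phiNH y t = (Real.sqrt t)⁻¹ * Real.exp (y ^ 2 / (2 * t)) := by
  rw [phiNH, Real.rpow_neg ht.le, ← Real.sqrt_eq_rpow]

theorem phiNH_pos {t : ℝ} (ht : 0 < t) (y : ℝ) : 0 < phiNH y t := by
  rw [phiNH_eq ht]
  have := Real.sqrt_pos.2 ht
  positivity

theorem hasDerivAt_phiNH (y t : ℝ) :
    HasDerivAt (fun z => phiNH z t)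
      (t ^ (-(1 / 2) : ℝ) * (Real.exp (y ^ 2 / (2 * t)) * (y / t))) y := by
  have h : HasDerivAt (fun z : ℝ => z ^ 2 / (2 * t)) (y / t) y := by
    refine (((hasDerivAt_id y).pow 2).div_const (2 * t)).congr_deriv ?_
    simp only [id, Nat.cast_ofNat]
    -- The formula survives at `t = 0`, where division by zero gives zero.
    rcases eq_or_ne t 0 with rfl | h
    · simp
    · field_simp; simp
  exact h.exp.const_mul _

theorem potDeriv_phiNH (y t : ℝ) :
    potDeriv phiNH y t = phiNH y t * (y / t) := by
  rw [potDeriv, (hasDerivAt_phiNH y t).deriv, phiNH, mul_assoc]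

theorem potDeriv2_phiNH {t : ℝ} (ht : 0 < t) (y : ℝ) :
    potDeriv2 phiNH y t = phiNH y t * ((1 + y ^ 2 / t) / t) := by
  have h1 : deriv (fun z => phiNH z t) = fun z => phiNH z t * (z / t) := by
    ext z; exact potDeriv_phiNH z t
  rw [potDeriv2, iteratedDeriv_succ, iteratedDeriv_one, h1]
  have := (hasDerivAt_phiNH y t).mul ((hasDerivAt_id y).div_const t)
  refine this.deriv.trans ?_
  simp only [phiNH, id]
  field_simp
  ring

theorem phiNH_le_of_sq_le {t : ℝ} (ht : 0 < t) {y z : ℝ} (h : y ^ 2 ≤ z ^ 2) :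
    phiNH y t ≤ phiNH z t := by
  rw [phiNH_eq ht, phiNH_eq ht]
  gcongr

theorem phiNH_antitone_time {t t' : ℝ} (ht : 0 < t) (h : t ≤ t') (y : ℝ) :
    phiNH y t' ≤ phiNH y t := by
  have := Real.sqrt_pos.2 ht
  rw [phiNH_eq ht, phiNH_eq (ht.trans_le h)]
  gcongr

/-- Projecting after the step can only bring the point closer to the origin. Upper bounds on the new
potential may thus ignore the second projection and expand a smooth function. -/
theorem phiNH_projNonneg_add_le {t : ℝ} (ht : 0 < t) (x d : ℝ) :
    phiNH (projNonneg (x + d)) t ≤ phiNH (projNonneg x + d) t := by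
  apply phiNH_le_of_sq_le ht
  unfold projNonneg
  rcases le_total (x + d) 0 with h | h
  · rw [max_eq_right h]; simpa using sq_nonneg _
  · rw [max_eq_left h]
    have := le_max_left x 0
    gcongr

/-- A tangent-line inequality: `max x 0 ^ 2` is convex in `x`, and `exp z ≥ 1 + z`. -/
theorem phiNH_projNonneg_add_ge {t : ℝ} (ht : 0 < t) (x d : ℝ) :
    phiNH (projNonneg x) t + potDeriv phiNH (projNonneg x) t * d
      ≤ phiNH (projNonneg (x + d)) t := by
  rw [potDeriv_phiNH]
  set y := projNonneg x with hy
  set y' := projNonneg (x + d) with hy'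
  have key : 2 * y * d ≤ y' ^ 2 - y ^ 2 := by
    simp only [hy, hy', projNonneg]
    rcases le_total x 0 with h | h <;> rcases le_total (x + d) 0 with h' | h' <;>
      simp only [h, h', max_eq_left, max_eq_right] <;> nlinarith [sq_nonneg d]
  have h1 : y' ^ 2 / (2 * t) = y ^ 2 / (2 * t) + (y' ^ 2 - y ^ 2) / (2 * t) := by ring
  have h2 : phiNH y' t = phiNH y t * Real.exp ((y' ^ 2 - y ^ 2) / (2 * t)) := by
    rw [phiNH_eq ht, phiNH_eq ht, h1, Real.exp_add, mul_assoc]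
  have h3 := Real.add_one_le_exp ((y' ^ 2 - y ^ 2) / (2 * t))
  have h4 : y / t * d ≤ (y' ^ 2 - y ^ 2) / (2 * t) := by
    rw [div_mul_eq_mul_div, div_le_div_iff₀ ht (by positivity)]
    nlinarith
  rw [h2]
  have := phiNH_pos ht y
  nlinarith

theorem continuousOn_phiNH_time (y : ℝ) : ContinuousOn (fun t => phiNH y t) (Set.Ioi 0) := by
  have h : Set.EqOn (fun t => phiNH y t)
      (fun t => (Real.sqrt t)⁻¹ * Real.exp (y ^ 2 / (2 * t))) (Set.Ioi 0) :=
    fun t ht => phiNH_eq ht y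
  refine ContinuousOn.congr ?_ h
  refine ContinuousOn.mul (Real.continuous_sqrt.continuousOn.inv₀ ?_)
    (Real.continuous_exp.comp_continuousOn (continuousOn_const.div (by fun_prop) ?_))
  · intro t ht; exact (Real.sqrt_pos.2 ht).ne'
  · intro t ht; have : 0 < t := ht; positivity

theorem tendsto_phiNH_time (y : ℝ) :
    Filter.Tendsto (fun t => phiNH y t) Filter.atTop (nhds 0) := by
  have h1 : Filter.Tendsto (fun t : ℝ => t ^ (-(1 / 2) : ℝ)) Filter.atTop (nhds 0) :=
    tendsto_rpow_neg_atTop (by norm_num)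
  have h2 : Filter.Tendsto (fun t : ℝ => y ^ 2 / (2 * t)) Filter.atTop (nhds 0) :=
    tendsto_const_nhds.div_atTop (Filter.tendsto_id.const_mul_atTop (by norm_num))
  simpa [phiNH] using h1.mul (Real.continuous_exp.continuousAt.tendsto.comp h2)

/-! ### Instantaneous regrets and existence of a run -/

theorem sum_mul_instRegret {N : ℕ} {p : Fin N → ℝ} (hp : p ∈ stdSimplex ℝ (Fin N))
    (l : Fin N → ℝ) : ∑ i, p i * instRegret p l i = 0 := by
  simp only [instRegret, mul_sub, Finset.sum_sub_distrib, ← Finset.sum_mul, hp.2, one_mul, sub_self]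

/-- The first-order change of the potential vanishes. The product form of `hg` also covers vanishing
derivatives, for which `p` is arbitrary. -/
theorem sum_deriv_mul_instRegret {N : ℕ} {p : Fin N → ℝ} (hp : p ∈ stdSimplex ℝ (Fin N))
    {g : Fin N → ℝ} (hg : ∀ i, p i * ∑ k, g k = g i) (l : Fin N → ℝ) :
    ∑ i, g i * instRegret p l i = 0 := by
  have : ∑ i, g i * instRegret p l i = (∑ k, g k) * ∑ i, p i * instRegret p l i := by
    rw [Finset.mul_sum]
    refine Finset.sum_congr rfl fun i _ => ?_
    calc g i * instRegret p l i = p i * (∑ k, g k) * instRegret p l i := by rw [hg i]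
      _ = _ := by ring
  rw [this, sum_mul_instRegret hp, mul_zero]

theorem abs_instRegret_le {N : ℕ} {p : Fin N → ℝ} (hp : p ∈ stdSimplex ℝ (Fin N))
    {l : Fin N → ℝ} {B : ℝ} (hl : ∀ i i', |l i - l i'| ≤ B) (i : Fin N) :
    |instRegret p l i| ≤ B := by
  have h : instRegret p l i = ∑ k, p k * (l k - l i) := by
    simp only [instRegret, mul_sub, Finset.sum_sub_distrib, ← Finset.sum_mul, hp.2, one_mul]
  rw [h]
  calc |∑ k, p k * (l k - l i)| ≤ ∑ k, |p k * (l k - l i)| := Finset.abs_sum_le_sum_abs _ _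
    _ ≤ ∑ k, p k * B := by
        refine Finset.sum_le_sum fun k _ => ?_
        rw [abs_mul, abs_of_nonneg (hp.1 k)]
        exact mul_le_mul_of_nonneg_left (hl k i) (hp.1 k)
    _ = B := by rw [← Finset.sum_mul, hp.2, one_mul]

theorem regretVec_succ {N : ℕ} (p ℓ : ℕ → Fin N → ℝ) (j : ℕ) (i : Fin N) :
    regretVec p ℓ (j + 1) i = regretVec p ℓ j i + instRegret (p j) (ℓ j) i :=
  Finset.sum_range_succ _ _

/-- A probability vector proportional to `g`, uniform if `g` sums to zero. -/
def propWeights {N : ℕ} (g : Fin N → ℝ) (i : Fin N) : ℝ :=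
  if ∑ k, g k = 0 then (N : ℝ)⁻¹ else g i / ∑ k, g k

theorem propWeights_mem {N : ℕ} (hN : 1 ≤ N) {g : Fin N → ℝ} (hg : ∀ i, 0 ≤ g i) :
    propWeights g ∈ stdSimplex ℝ (Fin N) := by
  have hN' : (N : ℝ) ≠ 0 := by positivity
  have hs : 0 ≤ ∑ k, g k := Finset.sum_nonneg fun k _ => hg k
  unfold propWeights
  split_ifs with h
  · exact ⟨fun i => by positivity, by simp [hN']⟩
  · exact ⟨fun i => div_nonneg (hg i) hs, by rw [← Finset.sum_div, div_self h]⟩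

theorem propWeights_mul {N : ℕ} {g : Fin N → ℝ} (hg : ∀ i, 0 ≤ g i) (i : Fin N) :
    propWeights g i * ∑ k, g k = g i := by
  unfold propWeights
  split_ifs with h
  · rw [h, mul_zero]
    exact ((Finset.sum_eq_zero_iff_of_nonneg fun k _ => hg k).1 h i (Finset.mem_univ i)).symm
  · rw [div_mul_cancel₀ _ h]

/-- Intermediate value theorem in time: at `t` the new potential is at least the old one by the
tangent-line inequality, and it tends to 0 as time grows. -/
theorem exists_time_const {N : ℕ} (hN : 1 ≤ N) {t : ℝ} (ht : 0 < t) {x d : Fin N → ℝ}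
    (h : ∑ i, potDeriv phiNH (projNonneg (x i)) t * d i = 0) :
    ∃ t', t ≤ t' ∧ totalPotential phiNH (fun i => projNonneg (x i + d i)) t'
      = totalPotential phiNH (fun i => projNonneg (x i)) t := by
  set c := totalPotential phiNH (fun i => projNonneg (x i)) t with hc
  set F := fun t' => totalPotential phiNH (fun i => projNonneg (x i + d i)) t' with hF
  have hcpos : 0 < c :=
    Finset.sum_pos (fun i _ => phiNH_pos ht _) ⟨⟨0, hN⟩, Finset.mem_univ _⟩
  have hcF : c ≤ F t := by
    have : c = ∑ i, (phiNH (projNonneg (x i)) t + potDeriv phiNH (projNonneg (x i)) t * d i) := by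
      rw [Finset.sum_add_distrib, h, add_zero]; rfl
    rw [this]
    exact Finset.sum_le_sum fun i _ => phiNH_projNonneg_add_ge ht _ _
  have hlim : Filter.Tendsto F Filter.atTop (nhds 0) := by
    have := tendsto_finsetSum Finset.univ
      fun (i : Fin N) _ => tendsto_phiNH_time (projNonneg (x i + d i))
    simpa [hF, totalPotential] using this
  obtain ⟨b, hb1, hb2⟩ := ((hlim.eventually_lt_const hcpos).and
    (Filter.eventually_ge_atTop t)).exists
  have hcont : ContinuousOn F (Set.Icc t b) :=
    continuousOn_finsetSum _ fun i _ => (continuousOn_phiNH_time _).mono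
      fun z hz => ht.trans_le hz.1
  obtain ⟨t', ht', hval⟩ := intermediate_value_Icc' hb2 hcont ⟨hb1.le, hcF⟩
  exact ⟨t', ht'.1, hval⟩

/-- The weights of the constant-potential algorithm. -/
def cpWeights {N : ℕ} (x : Fin N → ℝ) (t : ℝ) : Fin N → ℝ :=
  propWeights fun i => potDeriv phiNH (projNonneg (x i)) t

open Classical in
/-- The next time variable of the constant-potential algorithm. -/
def cpNextTime {N : ℕ} (x x' : Fin N → ℝ) (t : ℝ) : ℝ :=
  if h : ∃ t', t ≤ t' ∧ totalPotential phiNH (fun i => projNonneg (x' i)) t'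
      = totalPotential phiNH (fun i => projNonneg (x i)) t
  then h.choose else t

/-- The state (cumulative regrets and time) of the constant-potential algorithm. -/
def cpState {N : ℕ} (t₀ : ℝ) (ℓ : ℕ → Fin N → ℝ) : ℕ → (Fin N → ℝ) × ℝ
  | 0 => (fun _ => 0, t₀)
  | j + 1 =>
    let S := cpState t₀ ℓ j
    let x' := fun i => S.1 i + instRegret (cpWeights S.1 S.2) (ℓ j) i
    (x', cpNextTime S.1 x' S.2)

theorem exists_isCPRun {N : ℕ} (hN : 1 ≤ N) {t₀ : ℝ} (ht₀ : 0 < t₀) (ℓ : ℕ → Fin N → ℝ) :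
    ∃ (p : ℕ → Fin N → ℝ) (t : ℕ → ℝ), ∀ T, IsCPRun phiNH projNonneg t₀ T ℓ p t := by
  set p : ℕ → Fin N → ℝ := fun j => cpWeights (cpState t₀ ℓ j).1 (cpState t₀ ℓ j).2 with hp
  set t : ℕ → ℝ := fun j => (cpState t₀ ℓ j).2 with ht
  have hx : ∀ j, (cpState t₀ ℓ j).1 = regretVec p ℓ j := by
    intro j
    induction j with
    | zero => funext i; simp [cpState, regretVec]
    | succ j ih => funext i; rw [regretVec_succ, ← ih]; rfl
  have hstep : ∀ j, 0 < t j → t j ≤ t (j + 1) ∧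
      totalPotential phiNH (fun i => projNonneg (regretVec p ℓ (j + 1) i)) (t (j + 1))
        = totalPotential phiNH (fun i => projNonneg (regretVec p ℓ j i)) (t j) := by
    intro j hj
    have hg : ∀ i, 0 ≤ potDeriv phiNH (projNonneg ((cpState t₀ ℓ j).1 i)) (t j) := fun i => by
      rw [potDeriv_phiNH]
      exact mul_nonneg (phiNH_pos hj _).le (div_nonneg (le_max_right _ _) hj.le)
    have hex := exists_time_const hN hj (x := (cpState t₀ ℓ j).1)
      (sum_deriv_mul_instRegret (propWeights_mem hN hg) (propWeights_mul hg) (ℓ j))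
    have hs := hex.choose_spec
    have e : t (j + 1) = hex.choose := by
      simp only [ht, cpState, cpNextTime]
      exact dif_pos hex
    rw [← hx, ← hx, e]
    exact hs
  have hpos : ∀ j, 0 < t j := by
    intro j
    induction j with
    | zero => exact ht₀
    | succ j ih => exact ih.trans_le (hstep j ih).1
  have hg : ∀ j i, 0 ≤ potDeriv phiNH (projNonneg (regretVec p ℓ j i)) (t j) := fun j i => by
    rw [potDeriv_phiNH]
    exact mul_nonneg (phiNH_pos (hpos j) _).le (div_nonneg (le_max_right _ _) (hpos j).le)
  have hpe : ∀ j, p j = propWeights fun i => potDeriv phiNH (projNonneg (regretVec p ℓ j i)) (t j) :=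
    fun j => by rw [← hx]; rfl
  refine ⟨p, t, fun T => ⟨rfl, fun j _ => ?_, fun j _ i => ?_, fun j _ => (hstep j (hpos j)).1,
    fun j _ => (hstep j (hpos j)).2⟩⟩
  · rw [hpe]; exact propWeights_mem hN (hg j)
  · have := propWeights_mul (hg j) i
    rwa [← hpe] at this

/-! ### Second-order expansion and the coarse estimate of one round -/

/-- The error of the second-order expansion of the normalized potential. -/
def taylorErr (y d τ : ℝ) : ℝ :=
  |y * d| * d ^ 2 / 2 + d ^ 4 / 8 - τ ^ 2 / 3 + τ / 2 * y ^ 2 * (|y * d| + y ^ 2 * τ / 4)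
    + 2 / 9 * |y * d + d ^ 2 / 2 - y ^ 2 * τ / 2| ^ 3

theorem exp_le_cubic {z : ℝ} (hz : |z| ≤ 1) :
    Real.exp z ≤ 1 + z + z ^ 2 / 2 + 2 / 9 * |z| ^ 3 := by
  have h := (abs_le.1 (Real.exp_bound hz (n := 3) (by norm_num))).2
  simp [Finset.sum_range_succ, Nat.factorial] at h
  linarith

/-- The Taylor coefficient 3/8 of `τ²` is lowered to 1/3 to absorb the higher terms. -/
theorem one_add_mul_sqrt_ge {τ : ℝ} (h0 : 0 ≤ τ) (h1 : τ ≤ 1 / 2) :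
    1 + 3 / 2 * τ + τ ^ 2 / 3 ≤ (1 + τ) * Real.sqrt (1 + τ) := by
  have h : (1 + 3 / 2 * τ + τ ^ 2 / 3) / (1 + τ) ≤ Real.sqrt (1 + τ) := by
    apply Real.le_sqrt_of_sq_le
    rw [div_pow, div_le_iff₀ (by positivity)]
    nlinarith [sq_nonneg τ, mul_nonneg (sq_nonneg τ) (sub_nonneg.2 h1),
      mul_nonneg (mul_nonneg (sq_nonneg τ) h0) (sub_nonneg.2 h1)]
  rw [div_le_iff₀ (by positivity)] at h
  linarith

/-- The exponent equals `ζ / (1 + τ)` with `ζ = y d + d²/2 - y² τ/2`. The prefactor `1 + τ` makes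
the linear term exactly `ζ`, and the quadratic and cubic terms are then bounded by those of `ζ`. -/
theorem taylor_upper {y d τ : ℝ} (h0 : 0 ≤ τ) (h1 : τ ≤ 1 / 2)
    (hz : |y * d + d ^ 2 / 2 - y ^ 2 * τ / 2| ≤ 1) :
    (1 + τ) * Real.exp ((y + d) ^ 2 / (2 * (1 + τ)) - y ^ 2 / 2)
        - (1 + τ) * Real.sqrt (1 + τ)
      ≤ y * d + (1 + y ^ 2) * (d ^ 2 - τ) / 2 + taylorErr y d τ := by
  have hs : 0 < 1 + τ := by linarith
  set ζ := y * d + d ^ 2 / 2 - y ^ 2 * τ / 2 with hζ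
  have e : (y + d) ^ 2 / (2 * (1 + τ)) - y ^ 2 / 2 = ζ / (1 + τ) := by
    rw [hζ]; field_simp; ring
  have hle : |ζ / (1 + τ)| ≤ |ζ| := by
    rw [abs_div, abs_of_pos hs]
    exact div_le_self (abs_nonneg _) (by linarith)
  have hexp := exp_le_cubic (hle.trans hz)
  have hmul := mul_le_mul_of_nonneg_left hexp hs.le
  have hq : (1 + τ) * (ζ / (1 + τ)) = ζ := by field_simp
  have h2 : (1 + τ) * (ζ / (1 + τ)) ^ 2 ≤ ζ ^ 2 := by
    have : (1 + τ) * (ζ / (1 + τ)) ^ 2 = ζ ^ 2 / (1 + τ) := by field_simp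
    rw [this]
    exact div_le_self (sq_nonneg _) (by linarith)
  have h3 : (1 + τ) * |ζ / (1 + τ)| ^ 3 ≤ |ζ| ^ 3 := by
    have : (1 + τ) * |ζ / (1 + τ)| ^ 3 = |ζ| ^ 3 / (1 + τ) ^ 2 := by
      rw [abs_div, abs_of_pos hs]; field_simp
    rw [this]
    exact div_le_self (by positivity) (by nlinarith)
  have h4 := one_add_mul_sqrt_ge h0 h1
  have a1 : y * d * d ^ 2 ≤ |y * d| * d ^ 2 :=
    mul_le_mul_of_nonneg_right (le_abs_self _) (sq_nonneg _)
  have a2 : -(y * d) * (y ^ 2 * τ) ≤ |y * d| * (y ^ 2 * τ) :=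
    mul_le_mul_of_nonneg_right (neg_le_abs _) (by positivity)
  have a3 : 0 ≤ d ^ 2 * y ^ 2 * τ := by positivity
  rw [e, taylorErr, ← hζ]
  have hζ2 : ζ ^ 2 = y ^ 2 * d ^ 2 + y * d * d ^ 2 + d ^ 4 / 4 - y * d * (y ^ 2 * τ)
      - d ^ 2 * y ^ 2 * τ / 2 + y ^ 4 * τ ^ 2 / 4 := by rw [hζ]; ring
  nlinarith

/-- Summing `taylor_upper` with weights `exp (y²/2)`: orthogonality removes the linear terms, and
`hpot` makes the summed left side nonnegative. -/
theorem sum_curv_le_taylorErr {ι : Type*} [Fintype ι] {y d : ι → ℝ} {τ : ℝ}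
    (h0 : 0 ≤ τ) (h1 : τ ≤ 1 / 2)
    (hz : ∀ i, |y i * d i + d i ^ 2 / 2 - y i ^ 2 * τ / 2| ≤ 1)
    (horth : ∑ i, Real.exp (y i ^ 2 / 2) * (y i * d i) = 0)
    (hpot : Real.sqrt (1 + τ) * ∑ i, Real.exp (y i ^ 2 / 2)
      ≤ ∑ i, Real.exp ((y i + d i) ^ 2 / (2 * (1 + τ)))) :
    ∑ i, Real.exp (y i ^ 2 / 2) * ((1 + y i ^ 2) * (τ - d i ^ 2) / 2)
      ≤ ∑ i, Real.exp (y i ^ 2 / 2) * taylorErr (y i) (d i) τ := by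
  have hs : 0 < 1 + τ := by linarith
  have key : ∀ i, (1 + τ) * Real.exp ((y i + d i) ^ 2 / (2 * (1 + τ)))
      - (1 + τ) * (Real.sqrt (1 + τ) * Real.exp (y i ^ 2 / 2))
      ≤ Real.exp (y i ^ 2 / 2) * (y i * d i)
        - Real.exp (y i ^ 2 / 2) * ((1 + y i ^ 2) * (τ - d i ^ 2) / 2)
        + Real.exp (y i ^ 2 / 2) * taylorErr (y i) (d i) τ := by
    intro i
    have h := mul_le_mul_of_nonneg_left (taylor_upper h0 h1 (hz i)) (Real.exp_pos (y i ^ 2 / 2)).le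
    have e : Real.exp ((y i + d i) ^ 2 / (2 * (1 + τ)))
        = Real.exp (y i ^ 2 / 2) * Real.exp ((y i + d i) ^ 2 / (2 * (1 + τ)) - y i ^ 2 / 2) := by
      rw [← Real.exp_add]; congr 1; ring
    rw [e]
    linarith
  have hsum := Finset.sum_le_sum fun i (_ : i ∈ Finset.univ) => key i
  simp only [Finset.sum_add_distrib, Finset.sum_sub_distrib, ← Finset.mul_sum] at hsum
  rw [horth] at hsum
  have := mul_le_mul_of_nonneg_left hpot hs.le
  linarith

theorem taylorErr_le_coarse {y d τ h : ℝ} (h0 : 0 ≤ τ) (hτ : τ ≤ 2 * h ^ 2) (hd : |d| ≤ h)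
    (hh : h ^ 2 ≤ 1 / 2600) (hyh : y ^ 2 * h ^ 2 ≤ 1 / 1000) :
    |y * d + d ^ 2 / 2 - y ^ 2 * τ / 2| ≤ 33 / 1000 ∧
    taylorErr y d τ ≤ (1 + y ^ 2) * (31 / 1000 * d ^ 2 + 17 / 1000 * τ) := by
  have hd2 : d ^ 2 ≤ h ^ 2 := sq_le_sq' (by linarith [(abs_le.1 hd).1]) (abs_le.1 hd).2
  have hyd2 : (y * d) ^ 2 ≤ 1 / 1000 := by
    rw [mul_pow]; exact (mul_le_mul_of_nonneg_left hd2 (sq_nonneg y)).trans hyh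
  have hyd : |y * d| ≤ 317 / 10000 := abs_le_of_sq_le_sq (by linarith) (by norm_num)
  have hyτ : y ^ 2 * τ ≤ 1 / 500 := by nlinarith [sq_nonneg y]
  have hyτ0 : 0 ≤ y ^ 2 * τ := by positivity
  have hd0 := sq_nonneg d
  have hZ : |y * d + d ^ 2 / 2 - y ^ 2 * τ / 2| ≤ 33 / 1000 := by
    obtain ⟨l, r⟩ := abs_le.1 hyd
    rw [abs_le]; constructor <;> linarith
  refine ⟨hZ, ?_⟩
  set ζ := y * d + d ^ 2 / 2 - y ^ 2 * τ / 2 with hζ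
  have hζ3 : |ζ| ^ 3 ≤ 33 / 1000 * ζ ^ 2 := by
    have : |ζ| ^ 3 = |ζ| * ζ ^ 2 := by rw [← sq_abs ζ]; ring
    rw [this]; exact mul_le_mul_of_nonneg_right hZ (sq_nonneg _)
  have hζ2 : ζ ^ 2 ≤ 2 * (y ^ 2 * d ^ 2) + d ^ 4 / 2 + (y ^ 2 * τ) ^ 2 / 2 := by
    rw [hζ]
    nlinarith [sq_nonneg (y * d - (d ^ 2 / 2 - y ^ 2 * τ / 2)), mul_nonneg hd0 hyτ0]
  have b1 : |y * d| * d ^ 2 ≤ 317 / 10000 * d ^ 2 := mul_le_mul_of_nonneg_right hyd hd0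
  have b2 : d ^ 4 ≤ 1 / 2600 * d ^ 2 := by
    have : d ^ 4 = d ^ 2 * d ^ 2 := by ring
    rw [this]; exact mul_le_mul_of_nonneg_right (hd2.trans hh) hd0
  have b3 : (y ^ 2 * τ) ^ 2 ≤ 1 / 500 * (y ^ 2 * τ) := by nlinarith
  have b4 : (y ^ 2 * τ) * |y * d| ≤ (y ^ 2 * τ) * (317 / 10000) :=
    mul_le_mul_of_nonneg_left hyd hyτ0
  have b5 : 0 ≤ y ^ 2 * d ^ 2 := by positivity
  rw [taylorErr, ← hζ]
  have e : τ / 2 * y ^ 2 * (|y * d| + y ^ 2 * τ / 4)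
      = (y ^ 2 * τ) * |y * d| / 2 + (y ^ 2 * τ) ^ 2 / 8 := by ring
  rw [e]
  nlinarith [sq_nonneg τ]

theorem coarse_step {ι : Type*} [Fintype ι] {y d : ι → ℝ} {τ h : ℝ} (hpos : 0 < h)
    (h0 : 0 ≤ τ) (hd : ∀ i, |d i| ≤ h) (hh : h ^ 2 ≤ 1 / 2600)
    (hyh : ∀ i, y i ^ 2 * h ^ 2 ≤ 1 / 1000)
    (horth : ∑ i, Real.exp (y i ^ 2 / 2) * (y i * d i) = 0)
    (hpot : ∀ σ, 0 ≤ σ → σ ≤ τ → Real.sqrt (1 + σ) * ∑ i, Real.exp (y i ^ 2 / 2)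
      ≤ ∑ i, Real.exp ((y i + d i) ^ 2 / (2 * (1 + σ)))) [Nonempty ι] :
    τ ≤ 2 * h ^ 2 ∧ τ * ∑ i, Real.exp (y i ^ 2 / 2) * (1 + y i ^ 2)
      ≤ 10 / 9 * ∑ i, Real.exp (y i ^ 2 / 2) * (1 + y i ^ 2) * d i ^ 2 := by
  -- The expansion needs a priori control of the time step, so it is applied to every intermediate
  -- `σ`. The error constants give the ratio `(1/2 + 31/1000) / (1/2 - 17/1000) < 10/9`.
  have key : ∀ σ, 0 ≤ σ → σ ≤ τ → σ ≤ 2 * h ^ 2 →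
      σ * ∑ i, Real.exp (y i ^ 2 / 2) * (1 + y i ^ 2)
      ≤ 10 / 9 * ∑ i, Real.exp (y i ^ 2 / 2) * (1 + y i ^ 2) * d i ^ 2 := by
    intro σ hσ0 hστ hσh
    have hc := fun i => taylorErr_le_coarse hσ0 hσh (hd i) hh (hyh i)
    have hb := sum_curv_le_taylorErr hσ0 (by linarith)
      (fun i => (hc i).1.trans (by norm_num)) horth (hpot σ hσ0 hστ)
    have hb2 : ∑ i, Real.exp (y i ^ 2 / 2) * taylorErr (y i) (d i) σ
        ≤ ∑ i, Real.exp (y i ^ 2 / 2) *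
          ((1 + y i ^ 2) * (31 / 1000 * d i ^ 2 + 17 / 1000 * σ)) :=
      Finset.sum_le_sum fun i _ => mul_le_mul_of_nonneg_left (hc i).2 (Real.exp_pos _).le
    have e1 : ∑ i, Real.exp (y i ^ 2 / 2) * ((1 + y i ^ 2) * (σ - d i ^ 2) / 2)
        = σ / 2 * ∑ i, Real.exp (y i ^ 2 / 2) * (1 + y i ^ 2)
          - 1 / 2 * ∑ i, Real.exp (y i ^ 2 / 2) * (1 + y i ^ 2) * d i ^ 2 := by
      rw [Finset.mul_sum, Finset.mul_sum, ← Finset.sum_sub_distrib]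
      exact Finset.sum_congr rfl fun i _ => by ring
    have e2 : ∑ i, Real.exp (y i ^ 2 / 2) *
          ((1 + y i ^ 2) * (31 / 1000 * d i ^ 2 + 17 / 1000 * σ))
        = 31 / 1000 * ∑ i, Real.exp (y i ^ 2 / 2) * (1 + y i ^ 2) * d i ^ 2
          + 17 / 1000 * σ * ∑ i, Real.exp (y i ^ 2 / 2) * (1 + y i ^ 2) := by
      rw [Finset.mul_sum, Finset.mul_sum, ← Finset.sum_add_distrib]
      exact Finset.sum_congr rfl fun i _ => by ring
    have hQ : 0 ≤ ∑ i, Real.exp (y i ^ 2 / 2) * (1 + y i ^ 2) * d i ^ 2 :=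
      Finset.sum_nonneg fun i _ => by positivity
    linarith
  have hW : 0 < ∑ i, Real.exp (y i ^ 2 / 2) * (1 + y i ^ 2) :=
    Finset.sum_pos (fun i _ => by positivity) Finset.univ_nonempty
  -- If `τ` exceeded `2h²`, the choice `σ = 2h²` would give `2h² ≤ (10/9) h²`.
  have hτ : τ ≤ 2 * h ^ 2 := by
    by_contra hcon
    have h1 := key (2 * h ^ 2) (by positivity) (le_of_not_ge hcon) le_rfl
    have h2 : ∑ i, Real.exp (y i ^ 2 / 2) * (1 + y i ^ 2) * d i ^ 2
        ≤ ∑ i, Real.exp (y i ^ 2 / 2) * (1 + y i ^ 2) * h ^ 2 :=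
      Finset.sum_le_sum fun i _ => mul_le_mul_of_nonneg_left
        (sq_le_sq' (by linarith [(abs_le.1 (hd i)).1]) (abs_le.1 (hd i)).2) (by positivity)
    rw [← Finset.sum_mul] at h2
    nlinarith [mul_pos hW (pow_pos hpos 2)]
  exact ⟨hτ, key τ h0 le_rfl hτ⟩

/-! ### The fine estimate of one round for two experts -/

/-- Orthogonality forces `|y₁ d₁|` and `|y₂ d₂|` to agree up to a factor `M`, so each square is at
most `M` times their product, which AM-GM bounds by `D (1 + M) τ / 2`. Bounding each factor
separately would lose a constant that matters later. -/
theorem exists_cross_bound {v₁ v₂ y₁ y₂ d₁ d₂ τ D M : ℝ} (hτ : 0 < τ) (hD : 0 ≤ D)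
    (hv₁ : 1 ≤ v₁) (hv₂ : 1 ≤ v₂) (hw₁ : v₁ * (1 + y₁ ^ 2) ≤ M) (hw₂ : v₂ * (1 + y₂ ^ 2) ≤ M)
    (hy : y₁ ^ 2 + y₂ ^ 2 ≤ 2 * D) (horth : v₁ * (y₁ * d₁) + v₂ * (y₂ * d₂) = 0)
    (hcase : v₁ * (1 + y₁ ^ 2) * d₁ ^ 2 + v₂ * (1 + y₂ ^ 2) * d₂ ^ 2
      < τ * (v₁ * (1 + y₁ ^ 2) + v₂ * (1 + y₂ ^ 2))) :
    d₁ ^ 2 + d₂ ^ 2 ≤ (1 + M) * τ ∧ ∃ κ, 0 ≤ κ ∧ κ ^ 2 ≤ M * (1 + M) / 2 * D * τ ∧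
      |y₁ * d₁| ≤ κ ∧ |y₂ * d₂| ≤ κ := by
  have hy₁ := sq_nonneg y₁
  have hy₂ := sq_nonneg y₂
  have hd₁ := sq_nonneg d₁
  have hd₂ := sq_nonneg d₂
  have hW₁ : 1 ≤ v₁ * (1 + y₁ ^ 2) := by nlinarith
  have hW₂ : 1 ≤ v₂ * (1 + y₂ ^ 2) := by nlinarith
  have hv₁M : v₁ ≤ M := by nlinarith
  have hv₂M : v₂ ≤ M := by nlinarith
  have hM : 1 ≤ M := by linarith
  have hdd : d₁ ^ 2 + d₂ ^ 2 ≤ (1 + M) * τ := by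
    generalize v₁ * (1 + y₁ ^ 2) = w₁ at *
    generalize v₂ * (1 + y₂ ^ 2) = w₂ at *
    rcases le_total w₁ w₂ with h | h
    · have h1 : w₁ * (d₁ ^ 2 + d₂ ^ 2) ≤ w₁ * ((1 + M) * τ) := by
        nlinarith [mul_nonneg (sub_nonneg.2 h) hd₂, mul_nonneg hτ.le (sub_nonneg.2 hw₂),
          mul_nonneg (mul_nonneg hτ.le (sub_nonneg.2 hW₁)) (by linarith : 0 ≤ M)]
      exact le_of_mul_le_mul_left h1 (by linarith)
    · have h1 : w₂ * (d₁ ^ 2 + d₂ ^ 2) ≤ w₂ * ((1 + M) * τ) := by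
        nlinarith [mul_nonneg (sub_nonneg.2 h) hd₁, mul_nonneg hτ.le (sub_nonneg.2 hw₁),
          mul_nonneg (mul_nonneg hτ.le (sub_nonneg.2 hW₂)) (by linarith : 0 ≤ M)]
      exact le_of_mul_le_mul_left h1 (by linarith)
  have horth' : v₁ * |y₁ * d₁| = v₂ * |y₂ * d₂| := by
    have e1 : v₁ * |y₁ * d₁| = |v₁ * (y₁ * d₁)| := by rw [abs_mul v₁, abs_of_pos (by linarith : 0 < v₁)]
    have e2 : v₂ * |y₂ * d₂| = |v₂ * (y₂ * d₂)| := by rw [abs_mul v₂, abs_of_pos (by linarith : 0 < v₂)]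
    rw [e1, e2, eq_neg_of_add_eq_zero_left horth, abs_neg]
  have hprod : |y₁ * d₁| * |y₂ * d₂| ≤ D * ((1 + M) * τ / 2) := by
    have e : |y₁ * d₁| * |y₂ * d₂| = (|y₁| * |y₂|) * (|d₁| * |d₂|) := by
      simp only [abs_mul]; ring
    have a1 : |y₁| * |y₂| ≤ D := by
      nlinarith [sq_nonneg (|y₁| - |y₂|), sq_abs y₁, sq_abs y₂]
    have a2 : |d₁| * |d₂| ≤ (1 + M) * τ / 2 := by
      nlinarith [sq_nonneg (|d₁| - |d₂|), sq_abs d₁, sq_abs d₂]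
    rw [e]
    exact mul_le_mul a1 a2 (by positivity) hD
  set k₁ := |y₁ * d₁| with hk₁
  set k₂ := |y₂ * d₂| with hk₂
  have hk₁0 : 0 ≤ k₁ := abs_nonneg _
  have hk₂0 : 0 ≤ k₂ := abs_nonneg _
  have hk12 : k₁ ≤ M * k₂ := by
    have a1 := le_mul_of_one_le_left hk₁0 hv₁
    have a2 := mul_le_mul_of_nonneg_right hv₂M hk₂0
    linarith
  have hk21 : k₂ ≤ M * k₁ := by
    have a1 := le_mul_of_one_le_left hk₂0 hv₂
    have a2 := mul_le_mul_of_nonneg_right hv₁M hk₁0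
    linarith
  have hk₁s : k₁ ^ 2 ≤ M * (1 + M) / 2 * D * τ := by
    calc k₁ ^ 2 = k₁ * k₁ := sq _
      _ ≤ k₁ * (M * k₂) := mul_le_mul_of_nonneg_left hk12 hk₁0
      _ = M * (k₁ * k₂) := by ring
      _ ≤ M * (D * ((1 + M) * τ / 2)) := mul_le_mul_of_nonneg_left hprod (by linarith)
      _ = _ := by ring
  have hk₂s : k₂ ^ 2 ≤ M * (1 + M) / 2 * D * τ := by
    calc k₂ ^ 2 = k₂ * k₂ := sq _
      _ ≤ k₂ * (M * k₁) := mul_le_mul_of_nonneg_left hk21 hk₂0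
      _ = M * (k₁ * k₂) := by ring
      _ ≤ M * (D * ((1 + M) * τ / 2)) := mul_le_mul_of_nonneg_left hprod (by linarith)
      _ = _ := by ring
  refine ⟨hdd, ?_⟩
  rcases le_total k₁ k₂ with h | h
  · exact ⟨k₂, hk₂0, hk₂s, h, le_rfl⟩
  · exact ⟨k₁, hk₁0, hk₁s, le_rfl, h⟩

theorem mul_taylorErr_le {v y d τ D M κ : ℝ} (hτ : 0 < τ) (hD : 0 ≤ D) (hM : 1 ≤ M)
    (hκs : κ ^ 2 ≤ M * (1 + M) / 2 * D * τ)
    (hn : κ + ((1 + M) / 2 + D) * τ ≤ 1 / 50) (hv : 1 ≤ v) (hvM : v ≤ M) (hκ : |y * d| ≤ κ)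
    (hy : y ^ 2 ≤ 2 * D) (hd : d ^ 2 ≤ (1 + M) * τ) :
    v * taylorErr y d τ ≤ M * κ / 2 * d ^ 2 + M / 8 * (d ^ 2) ^ 2 - τ ^ 2 / 3
      + τ / 2 * M * y ^ 2 * (κ + D * τ / 2) + 2 / 9 * (M * (1 / 50 *
        (2 * (M * (1 + M) / 2 * D * τ) + 2 * (((1 + M) / 2 + D) * τ) ^ 2))) := by
  have cubic : |y * d + d ^ 2 / 2 - y ^ 2 * τ / 2| ^ 3
      ≤ 1 / 50 * (2 * (M * (1 + M) / 2 * D * τ) + 2 * (((1 + M) / 2 + D) * τ) ^ 2) := by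
    have b0 : y ^ 2 * τ ≤ 2 * D * τ := mul_le_mul_of_nonneg_right hy hτ.le
    have b1 : 0 ≤ y ^ 2 * τ := by positivity
    have b2 := sq_nonneg d
    have b3 : 0 ≤ D * τ := by positivity
    have hz : |y * d + d ^ 2 / 2 - y ^ 2 * τ / 2| ≤ κ + ((1 + M) / 2 + D) * τ := by
      obtain ⟨l, r⟩ := abs_le.1 hκ
      rw [abs_le]
      constructor <;> nlinarith
    have hz2 : |y * d + d ^ 2 / 2 - y ^ 2 * τ / 2| ^ 2
        ≤ 2 * (M * (1 + M) / 2 * D * τ) + 2 * (((1 + M) / 2 + D) * τ) ^ 2 := by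
      refine (pow_le_pow_left₀ (abs_nonneg _) hz 2).trans ?_
      have := sq_nonneg (κ - ((1 + M) / 2 + D) * τ)
      linarith
    rw [pow_succ, mul_comm]
    exact mul_le_mul (hz.trans hn) hz2 (by positivity) (by norm_num)
  have hC0 : 0 ≤ 1 / 50 * (2 * (M * (1 + M) / 2 * D * τ) + 2 * (((1 + M) / 2 + D) * τ) ^ 2) := by
    positivity
  generalize 1 / 50 * (2 * (M * (1 + M) / 2 * D * τ) + 2 * (((1 + M) / 2 + D) * τ) ^ 2) = C at *
  have hM0 : 0 ≤ M := by linarith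
  have f1 : v * (|y * d| * d ^ 2) ≤ M * (κ * d ^ 2) := by gcongr
  have f2 : v * (d ^ 2) ^ 2 ≤ M * (d ^ 2) ^ 2 := by gcongr
  have f3 : v * (y ^ 2 * (|y * d| + y ^ 2 * τ / 4)) ≤ M * (y ^ 2 * (κ + D * τ / 2)) := by
    have : y ^ 2 * τ / 4 ≤ D * τ / 2 := by nlinarith
    gcongr
  have f4 : v * |y * d + d ^ 2 / 2 - y ^ 2 * τ / 2| ^ 3 ≤ M * C := by gcongr
  have f5 : τ ^ 2 ≤ v * τ ^ 2 := le_mul_of_one_le_left (sq_nonneg _) hv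
  have f3' := mul_le_mul_of_nonneg_left f3 hτ.le
  unfold taylorErr
  linarith

theorem fine_core {v₁ v₂ y₁ y₂ d₁ d₂ τ D M : ℝ} (hτ : 0 < τ) (hD : 0 ≤ D)
    (hv₁ : 1 ≤ v₁) (hv₂ : 1 ≤ v₂) (hw₁ : v₁ * (1 + y₁ ^ 2) ≤ M) (hw₂ : v₂ * (1 + y₂ ^ 2) ≤ M)
    (hy : y₁ ^ 2 + y₂ ^ 2 ≤ 2 * D) (horth : v₁ * (y₁ * d₁) + v₂ * (y₂ * d₂) = 0)
    (hbase : v₁ * ((1 + y₁ ^ 2) * (τ - d₁ ^ 2) / 2) + v₂ * ((1 + y₂ ^ 2) * (τ - d₂ ^ 2) / 2)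
      ≤ v₁ * taylorErr y₁ d₁ τ + v₂ * taylorErr y₂ d₂ τ)
    (hnum : ∀ κ, 0 ≤ κ → κ ^ 2 ≤ M * (1 + M) / 2 * D * τ →
      κ + ((1 + M) / 2 + D) * τ ≤ 1 / 50 ∧
      M * (1 + M) / 2 * κ + M * (1 + M) ^ 2 / 8 * τ - 2 / 3 * τ + M * D * (κ + D * τ / 2)
        + 4 * M / 225 * (M * (1 + M) / 2 * D + ((1 + M) / 2 + D) ^ 2 * τ)
        ≤ 4 / 5 * D + 2 / 5 * τ) :
    τ * (1 - 4 / 5 * D - 2 / 5 * τ) * (v₁ * (1 + y₁ ^ 2) + v₂ * (1 + y₂ ^ 2))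
      ≤ v₁ * (1 + y₁ ^ 2) * d₁ ^ 2 + v₂ * (1 + y₂ ^ 2) * d₂ ^ 2 := by
  have hy₁ := sq_nonneg y₁
  have hy₂ := sq_nonneg y₂
  have hd₁ := sq_nonneg d₁
  have hd₂ := sq_nonneg d₂
  have hW₁ : 1 ≤ v₁ * (1 + y₁ ^ 2) := by nlinarith
  have hW₂ : 1 ≤ v₂ * (1 + y₂ ^ 2) := by nlinarith
  have hv₁M : v₁ ≤ M := by nlinarith
  have hv₂M : v₂ ≤ M := by nlinarith
  have hM : 1 ≤ M := by linarith
  -- If the weighted mean of `d²` already reaches `τ`, nothing is left to prove. Otherwise it is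
  -- below `τ`, which controls both `d²`.
  rcases le_or_gt (τ * (v₁ * (1 + y₁ ^ 2) + v₂ * (1 + y₂ ^ 2)))
    (v₁ * (1 + y₁ ^ 2) * d₁ ^ 2 + v₂ * (1 + y₂ ^ 2) * d₂ ^ 2) with hcase | hcase
  · refine le_trans ?_ hcase
    refine mul_le_mul_of_nonneg_right ?_ (by linarith)
    exact mul_le_of_le_one_right hτ.le (by linarith)
  obtain ⟨hdd, κ, hκ0, hκs, hκ₁, hκ₂⟩ :=
    exists_cross_bound hτ hD hv₁ hv₂ hw₁ hw₂ hy horth hcase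
  obtain ⟨hn1, hn2⟩ := hnum κ hκ0 hκs
  have bound := fun v y d h1 h2 h3 h4 h5 => mul_taylorErr_le (v := v) (y := y) (d := d)
    hτ hD hM hκs hn1 h1 h2 h3 h4 h5
  have hb₁ := bound v₁ y₁ d₁ hv₁ hv₁M hκ₁ (by linarith) (by linarith)
  have hb₂ := bound v₂ y₂ d₂ hv₂ hv₂M hκ₂ (by linarith) (by linarith)
  have g1 : M * κ / 2 * (d₁ ^ 2 + d₂ ^ 2) ≤ M * κ / 2 * ((1 + M) * τ) := by gcongr
  have g2 : M / 8 * ((d₁ ^ 2) ^ 2 + (d₂ ^ 2) ^ 2) ≤ M / 8 * ((1 + M) * τ) ^ 2 := by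
    refine mul_le_mul_of_nonneg_left ?_ (by linarith)
    have h1 := pow_le_pow_left₀ (by linarith) hdd 2
    have h2 := mul_nonneg hd₁ hd₂
    linarith only [h1, h2]
  have g3 : τ / 2 * M * (κ + D * τ / 2) * (y₁ ^ 2 + y₂ ^ 2)
      ≤ τ / 2 * M * (κ + D * τ / 2) * (2 * D) := by gcongr
  have g4 := mul_le_mul_of_nonneg_left hn2 hτ.le
  have hrem : v₁ * taylorErr y₁ d₁ τ + v₂ * taylorErr y₂ d₂ τ ≤ τ * (4 / 5 * D + 2 / 5 * τ) := by
    linarith only [hb₁, hb₂, g1, g2, g3, g4]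
  -- Both curvature weights are at least 1, so the unweighted remainder can be charged to their sum.
  have g5 : τ * (4 / 5 * D + 2 / 5 * τ) * 2
      ≤ τ * (4 / 5 * D + 2 / 5 * τ) * (v₁ * (1 + y₁ ^ 2) + v₂ * (1 + y₂ ^ 2)) :=
    mul_le_mul_of_nonneg_left (by linarith only [hW₁, hW₂]) (by positivity)
  linarith only [hbase, hrem, g5]

theorem exp_half_sq_mul_le {y D b : ℝ} (hy : y ^ 2 ≤ 2 * D) (hDb : D ≤ b) (hb : b < 1) :
    Real.exp (y ^ 2 / 2) * (1 + y ^ 2) ≤ (1 + 2 * b) / (1 - b) := by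
  have hD : 0 ≤ D := by nlinarith [sq_nonneg y]
  have h1 : Real.exp (y ^ 2 / 2) ≤ 1 / (1 - b) := by
    refine (Real.exp_le_exp.2 (by linarith : y ^ 2 / 2 ≤ b)).trans ?_
    exact Real.exp_bound_div_one_sub_of_interval (by linarith) hb
  calc Real.exp (y ^ 2 / 2) * (1 + y ^ 2) ≤ 1 / (1 - b) * (1 + 2 * b) := by
        have : 0 < 1 - b := by linarith
        gcongr; linarith
    _ = _ := by ring

theorem fine_step {y₁ y₂ d₁ d₂ τ D : ℝ} (hτ : 0 ≤ τ) (hτ' : τ ≤ 1 / 2340)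
    (hD : 0 ≤ D) (hD' : D ≤ 1 / 4) (hy : y₁ ^ 2 + y₂ ^ 2 ≤ 2 * D)
    (horth : Real.exp (y₁ ^ 2 / 2) * (y₁ * d₁) + Real.exp (y₂ ^ 2 / 2) * (y₂ * d₂) = 0)
    (hbase : Real.exp (y₁ ^ 2 / 2) * ((1 + y₁ ^ 2) * (τ - d₁ ^ 2) / 2)
        + Real.exp (y₂ ^ 2 / 2) * ((1 + y₂ ^ 2) * (τ - d₂ ^ 2) / 2)
      ≤ Real.exp (y₁ ^ 2 / 2) * taylorErr y₁ d₁ τ + Real.exp (y₂ ^ 2 / 2) * taylorErr y₂ d₂ τ) :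
    τ * (1 - 4 / 5 * D - 2 / 5 * τ)
        * (Real.exp (y₁ ^ 2 / 2) * (1 + y₁ ^ 2) + Real.exp (y₂ ^ 2 / 2) * (1 + y₂ ^ 2))
      ≤ Real.exp (y₁ ^ 2 / 2) * (1 + y₁ ^ 2) * d₁ ^ 2
        + Real.exp (y₂ ^ 2 / 2) * (1 + y₂ ^ 2) * d₂ ^ 2 := by
  rcases hτ.eq_or_lt with rfl | hτ
  · rw [zero_mul, zero_mul]; positivity
  have hy₁ := sq_nonneg y₁
  have hy₂ := sq_nonneg y₂
  have hv : ∀ y : ℝ, 1 ≤ Real.exp (y ^ 2 / 2) := fun y => Real.one_le_exp (by positivity)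
  have hDτ : 0 ≤ D * τ := by positivity
  have hDτ' : D * τ ≤ 1 / 9360 := by nlinarith
  -- On each range `D ≤ b` the weight bound is `M = (1 + 2b)/(1 - b)`, rounded up. Only for `D ≤
  -- 1/50` can `τ` be comparable to `D`; there `κ`, of order `√(Dτ)`, is split by AM-GM. On the
  -- other ranges `κ` is a small multiple of `D`.
  rcases le_or_gt D (1 / 50) with h1 | h1
  · have e := fun y h => (exp_half_sq_mul_le (y := y) h h1 (by norm_num)).trans
      (by norm_num : _ ≤ (10615 / 10000 : ℝ))
    refine fine_core hτ hD (hv _) (hv _) (e _ (by linarith)) (e _ (by linarith)) hy horth hbase ?_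
    intro κ hκ hκs
    norm_num at hκs ⊢
    have k1 : κ ≤ 1 / 100 := by nlinarith
    have k2 : 10942 / 10000 * κ ≤ 755 / 1000 * D + 477 / 1000 * τ := by
      refine abs_le_of_sq_le_sq' (a := 10942 / 10000 * κ) ?_ (by positivity) |>.2
      nlinarith [sq_nonneg (755 / 1000 * D - 477 / 1000 * τ)]
    refine ⟨by nlinarith, ?_⟩
    nlinarith [mul_nonneg hD (sub_nonneg.2 k1), mul_nonneg hDτ hD]
  rcases le_or_gt D (1 / 10) with h2 | h2
  · have e := fun y h => (exp_half_sq_mul_le (y := y) h h2 (by norm_num)).trans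
      (by norm_num : _ ≤ (134 / 100 : ℝ))
    refine fine_core hτ hD (hv _) (hv _) (e _ (by linarith)) (e _ (by linarith)) hy horth hbase ?_
    intro κ hκ hκs
    norm_num at hκs ⊢
    have k1 : κ ≤ 15 / 1000 := by nlinarith
    have k3 : τ ≤ 1 / 46 * D := by linarith
    have k2 : κ ≤ 1 / 5 * D := by
      refine abs_le_of_sq_le_sq' (a := κ) ?_ (by positivity) |>.2
      nlinarith
    refine ⟨by nlinarith, ?_⟩
    nlinarith [mul_nonneg hD (sub_nonneg.2 k1), mul_nonneg hDτ hD]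
  · have e := fun y h => (exp_half_sq_mul_le (y := y) h hD' (by norm_num)).trans
      (by norm_num : _ ≤ (2 : ℝ))
    refine fine_core hτ hD (hv _) (hv _) (e _ (by linarith)) (e _ (by linarith)) hy horth hbase ?_
    intro κ hκ hκs
    norm_num at hκs ⊢
    have k1 : κ ≤ 18 / 1000 := by nlinarith
    have k3 : τ ≤ 1 / 230 * D := by linarith
    have k2 : κ ≤ 1 / 8 * D := by
      refine abs_le_of_sq_le_sq' (a := κ) ?_ (by positivity) |>.2
      nlinarith
    refine ⟨by nlinarith, ?_⟩
    nlinarith [mul_nonneg hD (sub_nonneg.2 k1), mul_nonneg hDτ hD]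

/-! ### Scalar logarithmic inequalities -/

/-- Reduction to a polynomial inequality, through `log (X²/u) ≤ X²/u - 1` and `log u ≥ 2(u - 1)/(u +
1)`. -/
theorem two_mul_log_le {t u X : ℝ} (hX : 0 < X) (ht : 0 < t) (htu : t ≤ u) (hu : 1 ≤ u)
    (h : t * (X ^ 2 - u) * (u + 1) ≤ 2 * u * (u - t) * (u - 1)) :
    2 * t * Real.log X ≤ u * Real.log u := by
  have hu0 : 0 < u := by linarith
  have h1 : 2 * Real.log X ≤ Real.log u + (X ^ 2 / u - 1) := by
    have := Real.log_le_sub_one_of_pos (by positivity : 0 < X ^ 2 / u)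
    rw [Real.log_div (by positivity) hu0.ne', Real.log_pow] at this
    push_cast at this
    linarith
  have h2 : 2 * (u - 1) / (u + 1) ≤ Real.log u := by
    have := Real.le_log_one_add_of_nonneg (sub_nonneg.2 hu)
    convert this using 2 <;> ring
  have h3 : t * (X ^ 2 / u - 1) ≤ (u - t) * (2 * (u - 1) / (u + 1)) := by
    have e1 : t * (X ^ 2 / u - 1) = t * (X ^ 2 - u) / u := by field_simp
    rw [e1, ← mul_div_assoc, div_le_div_iff₀ hu0 (by linarith)]
    linarith
  nlinarith [mul_le_mul_of_nonneg_left h1 ht.le,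
    mul_le_mul_of_nonneg_left h2 (sub_nonneg.2 htu)]

theorem mul_log_mono {a b : ℝ} (ha : 1 ≤ a) (h : a ≤ b) : a * Real.log a ≤ b * Real.log b :=
  mul_le_mul h (Real.log_le_log (by linarith) h) (Real.log_nonneg ha) (by linarith)

theorem log_bound_of_large {s u X : ℝ} (hs : 1 ≤ s) (hs2 : 5 / 4 ≤ s ^ 2) (hX : 0 < X)
    (hX' : X ≤ 2 * s - 1) (hu : 1 + 9 / 5 * (s ^ 2 - 1) ≤ u) :
    2 * s ^ 2 * Real.log X ≤ u * Real.log u := by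
  refine le_trans ?_ (mul_log_mono (by nlinarith) hu)
  apply two_mul_log_le hX (by positivity) (by nlinarith) (by nlinarith)
  have h1 : X ^ 2 ≤ (2 * s - 1) ^ 2 := pow_le_pow_left₀ hX.le hX' 2
  have hs' : 111 / 100 ≤ s := by nlinarith
  set u := 1 + 9 / 5 * (s ^ 2 - 1) with hu
  have hu1 : 1 ≤ u := by nlinarith
  have h2 : s ^ 2 * (X ^ 2 - u) * (u + 1) ≤ s ^ 2 * ((2 * s - 1) ^ 2 - u) * (u + 1) := by
    gcongr
  refine h2.trans ?_
  -- After a common factor `s - 1` is removed, the polynomial inequality is expanded around 1.11,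
  -- just below `√(5/4)`.
  obtain ⟨q, hq⟩ : ∃ q, s = 111 / 100 + q := ⟨s - 111 / 100, by ring⟩
  have hq0 : 0 ≤ q := by linarith
  have h3 : s ^ 2 * (11 / 5 * s - 9 / 5) * (u + 1) ≤ 2 * u * (36 / 25) * (s - 1) * (s + 1) ^ 2 := by
    rw [hu]
    rw [hq] at hs2 ⊢
    nlinarith [pow_nonneg hq0 2, pow_nonneg hq0 3, pow_nonneg hq0 4, pow_nonneg hq0 5]
  have h4 := mul_le_mul_of_nonneg_left h3 (by linarith : 0 ≤ s - 1)
  have e1 : s ^ 2 * ((2 * s - 1) ^ 2 - u) * (u + 1)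
      = (s - 1) * (s ^ 2 * (11 / 5 * s - 9 / 5) * (u + 1)) := by rw [hu]; ring
  have e2 : 2 * u * (u - s ^ 2) * (u - 1)
      = (s - 1) * (2 * u * (36 / 25) * (s - 1) * (s + 1) ^ 2) := by rw [hu]; ring
  rw [e1, e2]
  exact h4

theorem log_bound_of_small {s u X : ℝ} (hs : 1 ≤ s) (hs2 : s ^ 2 ≤ 5 / 4) (hX : 0 < X)
    (hX' : X ≤ 2 * s - 1)
    (hu : 1 + 2 * (s ^ 2 - 1) - 4 / 5 * (s ^ 2 - 1) ^ 2 ≤ u) :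
    2 * s ^ 2 * Real.log X ≤ u * Real.log u := by
  obtain ⟨D, hD⟩ : ∃ D, s ^ 2 = 1 + D := ⟨s ^ 2 - 1, by ring⟩
  have hD0 : 0 ≤ D := by nlinarith
  have hD1 : D ≤ 1 / 4 := by linarith
  have hu' : 1 + 2 * D - 4 / 5 * D ^ 2 ≤ u := by rw [hD] at hu; linarith
  refine le_trans ?_ (mul_log_mono (by nlinarith) hu')
  apply two_mul_log_le hX (by positivity) (by nlinarith) (by nlinarith)
  have h1 : X ^ 2 ≤ (2 * s - 1) ^ 2 := pow_le_pow_left₀ hX.le hX' 2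
  have hs3 : 1 + D / 2 - D ^ 2 / 8 ≤ s := by
    refine abs_le_of_sq_le_sq' (a := 1 + D / 2 - D ^ 2 / 8) ?_ (by linarith) |>.2
    rw [hD]
    nlinarith [pow_nonneg hD0 3, pow_nonneg hD0 4]
  -- The first-order terms cancel: `(2s - 1)² = 5 + 4D - 4s ≤ 1 + 2D + D²/2`. This is why the
  -- coefficient 2 of `D` in `hu` cannot be relaxed to 9/5.
  have h2 : X ^ 2 - (1 + 2 * D - 4 / 5 * D ^ 2) ≤ 13 / 10 * D ^ 2 := by nlinarith
  rw [hD]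
  have h3 : (1 + D) * (X ^ 2 - (1 + 2 * D - 4 / 5 * D ^ 2)) * ((1 + 2 * D - 4 / 5 * D ^ 2) + 1)
      ≤ (1 + D) * (13 / 10 * D ^ 2) * ((1 + 2 * D - 4 / 5 * D ^ 2) + 1) := by
    have : 0 ≤ (1 + 2 * D - 4 / 5 * D ^ 2) + 1 := by nlinarith
    gcongr
  refine h3.trans ?_
  have h4 : (1 + D) * (13 / 10) * (2 + 2 * D - 4 / 5 * D ^ 2)
      ≤ 2 * (1 + 2 * D - 4 / 5 * D ^ 2) * (1 - 4 / 5 * D) * (2 - 4 / 5 * D) := by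
    nlinarith [pow_nonneg hD0 2, pow_nonneg hD0 3, pow_nonneg hD0 4,
      mul_nonneg hD0 (sub_nonneg.2 hD1), mul_nonneg (pow_nonneg hD0 2) (sub_nonneg.2 hD1),
      mul_nonneg (pow_nonneg hD0 3) (sub_nonneg.2 hD1)]
  have h5 := mul_le_mul_of_nonneg_left h4 (sq_nonneg D)
  linarith

theorem log_bound_of_sq_le {s u X : ℝ} (hs : 1 ≤ s) (hX : 0 < X)
    (hX2 : X ^ 2 ≤ 1 + 9 / 5 * (s ^ 2 - 1)) (hu : 1 + 9 / 5 * (s ^ 2 - 1) ≤ u) :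
    2 * s ^ 2 * Real.log X ≤ u * Real.log u := by
  refine le_trans ?_ (mul_log_mono (by nlinarith) hu)
  have h := Real.log_le_log (by positivity) hX2
  rw [Real.log_pow] at h
  push_cast at h
  have h0 : 0 ≤ Real.log (1 + 9 / 5 * (s ^ 2 - 1)) := Real.log_nonneg (by nlinarith)
  nlinarith [mul_le_mul_of_nonneg_left h (sq_nonneg s),
    mul_nonneg (by nlinarith : 0 ≤ 4 / 5 * (s ^ 2 - 1)) h0]

/-! ### Order statistics and the normalized run -/

theorem sum_ge_of_kthLargest {N m : ℕ} (hm : 1 ≤ m) (hmN : m ≤ N) (x : Fin N → ℝ)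
    {g : ℝ → ℝ} {c : ℝ} (hc : ∀ z, c ≤ g z)
    (hg : ∀ z, kthLargest x m ≤ z → g (kthLargest x m) ≤ g z) :
    m * g (kthLargest x m) + (N - m) * c ≤ ∑ i, g (x i) := by
  have hlt : m - 1 < N := by omega
  set R := kthLargest x m with hR
  have hRe : R = x (Tuple.sort (fun i => -x i) ⟨m - 1, hlt⟩) := by
    rw [hR, kthLargest, dif_pos hlt]
  rw [← Equiv.sum_comp (Tuple.sort fun i => -x i)]
  have h1 : ∀ k : Fin N, c + (if k.val < m then g R - c else 0)
      ≤ g (x (Tuple.sort (fun i => -x i) k)) := by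
    intro k
    split_ifs with hk
    · have hmono := Tuple.monotone_sort (fun i => -x i)
        (show k ≤ ⟨m - 1, hlt⟩ from Fin.mk_le_mk.2 (by omega))
      simp only [Function.comp_apply, ← hRe] at hmono
      have := hg _ (neg_le_neg_iff.1 hmono)
      linarith
    · rw [add_zero]; exact hc _
  refine le_trans (le_of_eq ?_) (Finset.sum_le_sum fun k _ => h1 k)
  rw [Finset.sum_add_distrib, ← Finset.sum_filter, Finset.sum_const, Finset.sum_const,
    Fin.card_filter_val_lt, min_eq_right hmN]
  simp only [Finset.card_univ, Fintype.card_fin, nsmul_eq_mul]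
  ring

theorem div_sqrt_sq {t : ℝ} (ht : 0 < t) (x : ℝ) : (x / Real.sqrt t) ^ 2 = x ^ 2 / t := by
  rw [div_pow, Real.sq_sqrt ht.le]

theorem phiNH_normalized {t : ℝ} (ht : 0 < t) (x : ℝ) :
    phiNH x t = (Real.sqrt t)⁻¹ * Real.exp ((x / Real.sqrt t) ^ 2 / 2) := by
  rw [phiNH_eq ht, div_sqrt_sq ht, div_div, mul_comm t]

/-- The regrets after `j` rounds, projected and divided by the square root of the time. -/
def normRegret {N : ℕ} (ℓ p : ℕ → Fin N → ℝ) (t : ℕ → ℝ) (j : ℕ) (i : Fin N) : ℝ :=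
  projNonneg (regretVec p ℓ j i) / Real.sqrt (t j)

/-- The instantaneous regrets of a round, divided by the square root of the time. -/
def normStep {N : ℕ} (ℓ p : ℕ → Fin N → ℝ) (t : ℕ → ℝ) (j : ℕ) (i : Fin N) : ℝ :=
  instRegret (p j) (ℓ j) i / Real.sqrt (t j)

section Run

variable {N T : ℕ} {t₀ : ℝ} {ℓ p : ℕ → Fin N → ℝ} {t : ℕ → ℝ}

theorem run_time_ge (h : IsCPRun phiNH projNonneg t₀ T ℓ p t) :
    ∀ j ≤ T, t₀ ≤ t j := by
  intro j
  induction j with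
  | zero => intro _; rw [h.init]
  | succ j ih => intro hj; exact (ih (by omega)).trans (h.mono j (by omega))

theorem run_potential (h : IsCPRun phiNH projNonneg t₀ T ℓ p t) :
    ∀ j ≤ T, totalPotential phiNH (fun i => projNonneg (regretVec p ℓ j i)) (t j)
      = N * phiNH 0 t₀ := by
  intro j
  induction j with
  | zero => intro _; simp [totalPotential, regretVec, projNonneg, h.init]
  | succ j ih => intro hj; rw [h.const j (by omega), ih (by omega)]

theorem run_sum_exp (ht₀ : 0 < t₀) (h : IsCPRun phiNH projNonneg t₀ T ℓ p t) {j : ℕ} (hj : j ≤ T) :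
    ∑ i, Real.exp (normRegret ℓ p t j i ^ 2 / 2) = N * Real.sqrt (t j / t₀) := by
  have htj : 0 < t j := ht₀.trans_le (run_time_ge h j hj)
  have h1 := run_potential h j hj
  simp only [totalPotential, phiNH_normalized htj, ← Finset.mul_sum] at h1
  rw [phiNH_eq ht₀] at h1
  have e0 := Real.sqrt_pos.2 htj
  have e1 := Real.sqrt_pos.2 ht₀
  rw [Real.sqrt_div htj.le]
  simp only [normRegret]
  simp at h1
  field_simp at h1 ⊢
  linarith

theorem run_orth (ht₀ : 0 < t₀) (h : IsCPRun phiNH projNonneg t₀ T ℓ p t) {j : ℕ} (hj : j < T) :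
    ∑ i, Real.exp (normRegret ℓ p t j i ^ 2 / 2) * (normRegret ℓ p t j i * normStep ℓ p t j i)
      = 0 := by
  have htj : 0 < t j := ht₀.trans_le (run_time_ge h j hj.le)
  have e0 := Real.sqrt_pos.2 htj
  have h1 := sum_deriv_mul_instRegret (h.prob j hj) (h.prop j hj) (ℓ j)
  have h2 : ∀ i, Real.exp (normRegret ℓ p t j i ^ 2 / 2)
        * (normRegret ℓ p t j i * normStep ℓ p t j i)
      = Real.sqrt (t j) *
        (potDeriv phiNH (projNonneg (regretVec p ℓ j i)) (t j) * instRegret (p j) (ℓ j) i) := by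
    intro i
    rw [potDeriv_phiNH, phiNH_normalized htj, normRegret, normStep]
    have : t j = Real.sqrt (t j) * Real.sqrt (t j) := (Real.mul_self_sqrt htj.le).symm
    generalize Real.exp _ = E
    rw [this]
    simp only [Real.sqrt_mul_self e0.le]
    field_simp
  rw [Finset.sum_congr rfl fun i _ => h2 i, ← Finset.mul_sum, h1, mul_zero]

/-- The potential decreases in time, so stopping the clock early at `t j * (1 + σ)` leaves it at
least at its constant value. The whole range of `σ` feeds the a priori bound in `coarse_step`. -/
theorem run_potential_growth (ht₀ : 0 < t₀) (h : IsCPRun phiNH projNonneg t₀ T ℓ p t)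
    {j : ℕ} (hj : j < T) {σ : ℝ} (hσ : 0 ≤ σ) (hσ' : σ ≤ (t (j + 1) - t j) / t j) :
    Real.sqrt (1 + σ) * ∑ i, Real.exp (normRegret ℓ p t j i ^ 2 / 2)
      ≤ ∑ i, Real.exp ((normRegret ℓ p t j i + normStep ℓ p t j i) ^ 2 / (2 * (1 + σ))) := by
  have htj : 0 < t j := ht₀.trans_le (run_time_ge h j hj.le)
  have e0 := Real.sqrt_pos.2 htj
  have e1 := Real.sqrt_pos.2 (by linarith : 0 < 1 + σ)
  have hs : 0 < t j * (1 + σ) := by positivity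
  have hle : t j * (1 + σ) ≤ t (j + 1) := by
    rw [le_div_iff₀ htj] at hσ'; linarith
  have h1 : totalPotential phiNH (fun i => projNonneg (regretVec p ℓ j i)) (t j)
      ≤ ∑ i, phiNH (projNonneg (regretVec p ℓ j i) + instRegret (p j) (ℓ j) i)
          (t j * (1 + σ)) := by
    rw [← h.const j hj]
    refine Finset.sum_le_sum fun i _ => ?_
    simp only [regretVec_succ]
    exact (phiNH_antitone_time hs hle _).trans (phiNH_projNonneg_add_le hs _ _)
  have h2 : ∀ i, phiNH (projNonneg (regretVec p ℓ j i) + instRegret (p j) (ℓ j) i)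
        (t j * (1 + σ))
      = (Real.sqrt (t j))⁻¹ * (Real.sqrt (1 + σ))⁻¹ *
        Real.exp ((normRegret ℓ p t j i + normStep ℓ p t j i) ^ 2 / (2 * (1 + σ))) := by
    intro i
    rw [phiNH_eq hs, Real.sqrt_mul htj.le, mul_inv, normRegret, normStep, ← add_div,
      div_sqrt_sq htj, div_div]
    congr 3; ring
  simp only [h2, ← Finset.mul_sum] at h1
  simp only [totalPotential, phiNH_normalized htj, ← Finset.mul_sum] at h1
  change (Real.sqrt (t j))⁻¹ * ∑ i, Real.exp (normRegret ℓ p t j i ^ 2 / 2) ≤ _ at h1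
  rw [mul_assoc] at h1
  have h3 := le_of_mul_le_mul_left h1 (inv_pos.2 e0)
  rwa [inv_mul_eq_div, le_div_iff₀ e1, mul_comm] at h3

theorem run_moment_succ (ht₀ : 0 < t₀) (h : IsCPRun phiNH projNonneg t₀ T ℓ p t)
    {j : ℕ} (hj : j < T) :
    cumSecondMoment phiNH projNonneg ℓ p t (j + 1)
      = cumSecondMoment phiNH projNonneg ℓ p t j + t j *
        ((∑ i, Real.exp (normRegret ℓ p t j i ^ 2 / 2) * (1 + normRegret ℓ p t j i ^ 2)
            * normStep ℓ p t j i ^ 2)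
          / ∑ i, Real.exp (normRegret ℓ p t j i ^ 2 / 2) * (1 + normRegret ℓ p t j i ^ 2)) := by
  have htj : 0 < t j := ht₀.trans_le (run_time_ge h j hj.le)
  have e0 := Real.sqrt_pos.2 htj
  have h2 : ∀ i, potDeriv2 phiNH (projNonneg (regretVec p ℓ j i)) (t j)
      = ((Real.sqrt (t j))⁻¹ / t j) *
        (Real.exp (normRegret ℓ p t j i ^ 2 / 2) * (1 + normRegret ℓ p t j i ^ 2)) := by
    intro i
    rw [potDeriv2_phiNH htj, phiNH_normalized htj, normRegret, div_sqrt_sq htj]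
    ring
  have hc : (Real.sqrt (t j))⁻¹ / t j ≠ 0 := by positivity
  rw [cumSecondMoment, Finset.sum_range_succ, ← cumSecondMoment]
  congr 1
  rw [Finset.sum_div, Finset.mul_sum]
  refine Finset.sum_congr rfl fun i _ => ?_
  simp only [curvWeight, h2, ← Finset.mul_sum]
  rw [mul_div_mul_left _ _ hc]
  simp only [normStep, div_sqrt_sq htj]
  field_simp

theorem run_normRegret_sq_le (ht₀ : 0 < t₀) (h : IsCPRun phiNH projNonneg t₀ T ℓ p t)
    (hN : 1 ≤ N) {j : ℕ} (hj : j ≤ T) (i : Fin N) :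
    normRegret ℓ p t j i ^ 2 ≤ 2 * Real.log N + (t j / t₀ - 1) := by
  have htj : 0 < t j := ht₀.trans_le (run_time_ge h j hj)
  have hr : 0 < t j / t₀ := div_pos htj ht₀
  have hN' : (0 : ℝ) < N := by positivity
  have h1 : Real.exp (normRegret ℓ p t j i ^ 2 / 2) ≤ N * Real.sqrt (t j / t₀) := by
    rw [← run_sum_exp ht₀ h hj]
    exact Finset.single_le_sum (f := fun i => Real.exp (normRegret ℓ p t j i ^ 2 / 2))
      (fun i _ => (Real.exp_pos _).le) (Finset.mem_univ i)
  have h2 := (Real.le_log_iff_exp_le (by positivity)).2 h1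
  rw [Real.log_mul hN'.ne' (Real.sqrt_pos.2 hr).ne', Real.log_sqrt hr.le] at h2
  have h3 := Real.log_le_sub_one_of_pos hr
  linarith

theorem run_step_coarse (ht₀ : 0 < t₀) (h : IsCPRun phiNH projNonneg t₀ T ℓ p t)
    (hN : 1 ≤ N) {B : ℝ} (hB : 0 < B) (hℓ : ∀ j i i', |ℓ j i - ℓ j i'| ≤ B)
    (hB1 : B ^ 2 / t₀ ≤ 1 / 2600) (hB2 : B ^ 2 / t₀ * (2 * Real.log N + 1) ≤ 1 / 1000)
    {j : ℕ} (hj : j < T) :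
    (∀ i, normRegret ℓ p t j i ^ 2 * (B / Real.sqrt (t j)) ^ 2 ≤ 1 / 1000) ∧
    (∀ i, |normStep ℓ p t j i| ≤ B / Real.sqrt (t j)) ∧
    (B / Real.sqrt (t j)) ^ 2 ≤ 1 / 2600 ∧
    (t (j + 1) - t j) / t j
      * ∑ i, Real.exp (normRegret ℓ p t j i ^ 2 / 2) * (1 + normRegret ℓ p t j i ^ 2)
      ≤ 10 / 9 * ∑ i, Real.exp (normRegret ℓ p t j i ^ 2 / 2) * (1 + normRegret ℓ p t j i ^ 2)
          * normStep ℓ p t j i ^ 2 := by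
  have htge := run_time_ge h j hj.le
  have htj : 0 < t j := ht₀.trans_le htge
  have e0 := Real.sqrt_pos.2 htj
  have hN' : (1 : ℝ) ≤ N := by exact_mod_cast hN
  have hlog := Real.log_nonneg hN'
  have hBt : B ^ 2 / t j ≤ B ^ 2 / t₀ := by gcongr
  have c1 : ∀ i, |normStep ℓ p t j i| ≤ B / Real.sqrt (t j) := fun i => by
    rw [normStep, abs_div, abs_of_pos e0]
    exact div_le_div_of_nonneg_right (abs_instRegret_le (h.prob j hj) (hℓ j) i) e0.le
  have c2 : (B / Real.sqrt (t j)) ^ 2 ≤ 1 / 2600 := by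
    rw [div_sqrt_sq htj]; exact hBt.trans hB1
  have c3 : ∀ i, normRegret ℓ p t j i ^ 2 * (B / Real.sqrt (t j)) ^ 2 ≤ 1 / 1000 := fun i => by
    rw [div_sqrt_sq htj]
    refine le_trans ?_ hB2
    have hy := run_normRegret_sq_le ht₀ h hN hj.le i
    have hb : 0 ≤ B ^ 2 / t j := by positivity
    -- The bound on the squared normalized regret grows like `t j / t₀`; the factor `1 / t j`
    -- cancels that growth, making the estimate uniform in the round.
    calc normRegret ℓ p t j i ^ 2 * (B ^ 2 / t j)
        ≤ (2 * Real.log N + (t j / t₀ - 1)) * (B ^ 2 / t j) := mul_le_mul_of_nonneg_right hy hb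
      _ ≤ 2 * Real.log N * (B ^ 2 / t j) + t j / t₀ * (B ^ 2 / t j) := by nlinarith
      _ = 2 * Real.log N * (B ^ 2 / t j) + B ^ 2 / t₀ := by
          congr 1; field_simp
      _ ≤ 2 * Real.log N * (B ^ 2 / t₀) + B ^ 2 / t₀ := by gcongr
      _ = _ := by ring
  have : Nonempty (Fin N) := ⟨⟨0, hN⟩⟩
  refine ⟨c3, c1, c2, (coarse_step (div_pos hB e0)
    (div_nonneg (sub_nonneg.2 (h.mono j hj)) htj.le) c1 c2 c3 (run_orth ht₀ h hj)
    fun σ h1 h2 => run_potential_growth ht₀ h hj h1 h2).2⟩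

theorem run_moment_ge (ht₀ : 0 < t₀) (h : IsCPRun phiNH projNonneg t₀ T ℓ p t)
    (hN : 1 ≤ N) {B : ℝ} (hB : 0 < B) (hℓ : ∀ j i i', |ℓ j i - ℓ j i'| ≤ B)
    (hB1 : B ^ 2 / t₀ ≤ 1 / 2600) (hB2 : B ^ 2 / t₀ * (2 * Real.log N + 1) ≤ 1 / 1000) :
    ∀ j ≤ T, 9 / 10 * (t j - t₀) ≤ cumSecondMoment phiNH projNonneg ℓ p t j := by
  intro j
  induction j with
  | zero => intro _; simp [h.init, cumSecondMoment]
  | succ j ih =>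
    intro hj
    have hj' : j < T := by omega
    have ih := ih hj'.le
    have htj : 0 < t j := ht₀.trans_le (run_time_ge h j hj'.le)
    have hc := (run_step_coarse ht₀ h hN hB hℓ hB1 hB2 hj').2.2.2
    have : Nonempty (Fin N) := ⟨⟨0, hN⟩⟩
    have hW : 0 < ∑ i, Real.exp (normRegret ℓ p t j i ^ 2 / 2) * (1 + normRegret ℓ p t j i ^ 2) :=
      Finset.sum_pos (fun i _ => by positivity) Finset.univ_nonempty
    rw [run_moment_succ ht₀ h hj']
    rw [← le_div_iff₀ hW, mul_div_assoc] at hc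
    have h2 := mul_le_mul_of_nonneg_left hc htj.le
    rw [mul_div_cancel₀ _ htj.ne'] at h2
    linarith

end Run

/-! ### Sharp second moment for two experts -/

theorem run_moment_ge_two {T : ℕ} {t₀ : ℝ} {ℓ p : ℕ → Fin 2 → ℝ} {t : ℕ → ℝ}
    (ht₀ : 0 < t₀) (h : IsCPRun phiNH projNonneg t₀ T ℓ p t)
    {B : ℝ} (hB : 0 < B) (hℓ : ∀ j i i', |ℓ j i - ℓ j i'| ≤ B)
    (hB1 : B ^ 2 / t₀ ≤ 1 / 2600)
    (hB2 : B ^ 2 / t₀ * (2 * Real.log (2 : ℕ) + 1) ≤ 1 / 1000) :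
    ∀ j ≤ T, t j / t₀ ≤ 5 / 4 →
      (t j / t₀ - 1) - 2 / 5 * (t j / t₀ - 1) ^ 2
        ≤ cumSecondMoment phiNH projNonneg ℓ p t j / t₀ := by
  intro j
  induction j with
  | zero => intro _ _; simp [h.init, cumSecondMoment, ht₀.ne']
  | succ j ih =>
    intro hj hD
    have hj' : j < T := by omega
    have hmono := h.mono j hj'
    have htge := run_time_ge h j hj'.le
    have htj : 0 < t j := ht₀.trans_le htge
    have hDj : t j / t₀ ≤ t (j + 1) / t₀ := by gcongr
    have ih := ih hj'.le (hDj.trans hD)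
    obtain ⟨c3, c1, c2, hc⟩ := run_step_coarse ht₀ h (by norm_num) hB hℓ hB1 hB2 hj'
    have hexp := run_sum_exp ht₀ h hj'.le
    have horth := run_orth ht₀ h hj'
    have hgrowth := fun σ h1 h2 => run_potential_growth (σ := σ) ht₀ h hj' h1 h2
    rw [run_moment_succ ht₀ h hj']
    obtain ⟨τ, hτ⟩ : ∃ τ, τ = (t (j + 1) - t j) / t j := ⟨_, rfl⟩
    have hτ0 : 0 ≤ τ := by rw [hτ]; exact div_nonneg (sub_nonneg.2 hmono) htj.le
    rw [← hτ] at hc hgrowth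
    generalize normRegret ℓ p t j = y at *
    generalize normStep ℓ p t j = d at *
    obtain ⟨D, hDdef⟩ : ∃ D, t j / t₀ = 1 + D := ⟨t j / t₀ - 1, by ring⟩
    have hD0 : 0 ≤ D := by
      have : 1 ≤ t j / t₀ := (one_le_div ht₀).2 htge
      linarith
    have hW : 0 < ∑ i, Real.exp (y i ^ 2 / 2) * (1 + y i ^ 2) :=
      Finset.sum_pos (fun i _ => by positivity) Finset.univ_nonempty
    have hd2 : ∀ i, d i ^ 2 ≤ 1 / 2600 := fun i =>
      (sq_le_sq' (by linarith [(abs_le.1 (c1 i)).1]) (abs_le.1 (c1 i)).2).trans c2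
    have hτ1 : τ ≤ 1 / 2340 := by
      have h2 : ∑ i, Real.exp (y i ^ 2 / 2) * (1 + y i ^ 2) * d i ^ 2
          ≤ ∑ i, Real.exp (y i ^ 2 / 2) * (1 + y i ^ 2) * (1 / 2600) :=
        Finset.sum_le_sum fun i _ => mul_le_mul_of_nonneg_left (hd2 i) (by positivity)
      rw [← Finset.sum_mul] at h2
      by_contra hcon
      push Not at hcon
      nlinarith [mul_lt_mul_of_pos_right hcon hW]
    -- Constancy of the potential and `exp z ≥ 1 + z` give `2 + (y₀² + y₁²)/2 ≤ 2 √(1 + D) ≤ 2 + D`.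
    have hy2 : y 0 ^ 2 + y 1 ^ 2 ≤ 2 * D := by
      rw [Fin.sum_univ_two, hDdef] at hexp
      have a0 := Real.add_one_le_exp (y 0 ^ 2 / 2)
      have a1 := Real.add_one_le_exp (y 1 ^ 2 / 2)
      have a2 : Real.sqrt (1 + D) ≤ 1 + D / 2 := by
        apply Real.sqrt_le_iff.2
        constructor <;> nlinarith
      push_cast at hexp
      linarith
    have hbase := sum_curv_le_taylorErr hτ0 (by linarith)
      (fun i => ?_) horth (hgrowth τ hτ0 le_rfl)
    · simp only [Fin.sum_univ_two] at hbase horth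
      have hf := fine_step hτ0 hτ1 hD0 (by linarith) hy2 horth hbase
      rw [← Fin.sum_univ_two (fun i => Real.exp (y i ^ 2 / 2) * (1 + y i ^ 2)),
        ← Fin.sum_univ_two (fun i => Real.exp (y i ^ 2 / 2) * (1 + y i ^ 2) * d i ^ 2),
        ← le_div_iff₀ hW] at hf
      generalize (∑ i, Real.exp (y i ^ 2 / 2) * (1 + y i ^ 2) * d i ^ 2)
        / ∑ i, Real.exp (y i ^ 2 / 2) * (1 + y i ^ 2) = Q at *
      have hnext : t (j + 1) / t₀ = 1 + D + (1 + D) * τ := by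
        rw [← hDdef, hτ]; field_simp; ring
      rw [hDdef] at ih
      rw [hnext, add_div, mul_div_right_comm, hDdef]
      have hf2 := mul_le_mul_of_nonneg_left hf (by linarith : 0 ≤ 1 + D)
      -- The new value of `D` is `D + (1 + D) τ`. The growth of `D - (2/5) D²` falls short of the
      -- lower bound for the moment increment by 2/5 of this term.
      have hf3 : 0 ≤ (1 + D) * D * τ ^ 2 := by positivity
      nlinarith
    · have h2 : τ ≤ 2 * (B / Real.sqrt (t j)) ^ 2 :=
        (coarse_step (div_pos hB (Real.sqrt_pos.2 htj)) hτ0 c1 c2 c3 horth hgrowth).1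
      exact (taylorErr_le_coarse hτ0 h2 (c1 i) c2 (c3 i)).1.trans (by norm_num)

/-! ### From the potential to the quantile bound -/

theorem startTime_bounds {N : ℕ} (hN : 2 ≤ N) (B : ℝ) :
    B ^ 2 / startTime N B ≤ 1 / 2600 ∧
      B ^ 2 / startTime N B * (2 * Real.log N + 1) ≤ 1 / 1000 := by
  have ht : 0 < startTime N B := lt_of_lt_of_le one_pos (le_max_right _ _)
  have h1 : 512 * Real.exp 1 ^ 2 * B ^ 2 * Real.log N ≤ startTime N B := le_max_left _ _
  have he : 7.38 ≤ Real.exp 1 ^ 2 := by nlinarith [Real.exp_one_gt_d9]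
  have hl : 0.693 ≤ Real.log N := by
    have h2 : Real.log 2 ≤ Real.log N := Real.log_le_log two_pos (by exact_mod_cast hN)
    linarith [Real.log_two_gt_d9]
  obtain ⟨b, hb⟩ : ∃ b, b = B ^ 2 / startTime N B := ⟨_, rfl⟩
  have hb0 : 0 ≤ b := by rw [hb]; positivity
  have hB : B ^ 2 = b * startTime N B := by rw [hb]; field_simp
  rw [← hb]
  rw [hB] at h1
  have h2 : 512 * 7.38 * (b * Real.log N) ≤ 1 := by
    have h3 : 512 * Real.exp 1 ^ 2 * (b * Real.log N) ≤ 1 := by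
      refine le_of_mul_le_mul_right ?_ ht
      linarith
    have h4 : 0 ≤ b * Real.log N := mul_nonneg hb0 (by linarith)
    nlinarith
  have h5 : b * 0.693 ≤ b * Real.log N := mul_le_mul_of_nonneg_left hl hb0
  norm_num at h2 h5
  constructor <;> linarith

theorem log_quantile_bound {N m : ℕ} (hN : 2 ≤ N) (hm : 1 ≤ m) (hmN : m + 1 ≤ N) {s u : ℝ}
    (hs : 1 ≤ s) (hu : 1 + 9 / 5 * (s ^ 2 - 1) ≤ u)
    (hu2 : N = 2 → s ^ 2 ≤ 5 / 4 → 1 + 2 * (s ^ 2 - 1) - 4 / 5 * (s ^ 2 - 1) ^ 2 ≤ u) :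
    2 * s ^ 2 * Real.log ((m + 1) / N * (1 + N / m * (s - 1))) ≤ u * Real.log u := by
  have hN' : (2 : ℝ) ≤ N := by exact_mod_cast hN
  have hm' : (1 : ℝ) ≤ m := by exact_mod_cast hm
  have hmN' : (m : ℝ) + 1 ≤ N := by exact_mod_cast hmN
  have hs0 : 0 ≤ s - 1 := by linarith
  have eX : ((m : ℝ) + 1) / N * (1 + N / m * (s - 1)) = (m + 1) / N + (1 + 1 / m) * (s - 1) := by
    field_simp
  set X := ((m : ℝ) + 1) / N * (1 + N / m * (s - 1)) with hX
  have hXpos : 0 < X := by positivity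
  have ha : ((m : ℝ) + 1) / N ≤ 1 := (div_le_one (by linarith)).2 hmN'
  have hb : 1 / (m : ℝ) ≤ 1 := (div_le_one (by linarith)).2 hm'
  have hX2 : X ≤ 2 * s - 1 := by rw [eX]; nlinarith
  rcases le_total (5 / 4) (s ^ 2) with hlarge | hsmall
  · exact log_bound_of_large hs hlarge hXpos hX2 hu
  -- Near `s = 1` the worst case `X = 2s - 1` needs `m = 1` and `N = 2`. For `N ≥ 3`, either the
  -- constant term of `X` is at most 2/3 (`m = 1`) or its slope is at most 3/2 (`m ≥ 2`).
  rcases hN.eq_or_lt with h2 | h3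
  · exact log_bound_of_small hs hsmall hXpos hX2 (hu2 h2.symm hsmall)
  have hs1 : s ≤ 9 / 8 := by nlinarith
  refine log_bound_of_sq_le hs hXpos ?_ hu
  rcases hm.eq_or_lt with h1 | h1
  · have hX3 : X ≤ 2 * s - 4 / 3 := by
      have hN3 : (3 : ℝ) ≤ N := by exact_mod_cast h3
      have : ((m : ℝ) + 1) / N ≤ 2 / 3 := by
        rw [← h1, div_le_div_iff₀ (by linarith) (by norm_num)]
        push_cast; linarith
      rw [eX]; nlinarith
    nlinarith [pow_le_pow_left₀ hXpos.le hX3 2]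
  · have hX3 : X ≤ 3 / 2 * s - 1 / 2 := by
      have hm2 : (2 : ℝ) ≤ m := by exact_mod_cast h1
      have : 1 / (m : ℝ) ≤ 1 / 2 := by gcongr
      rw [eX]; nlinarith
    nlinarith [pow_le_pow_left₀ hXpos.le hX3 2]

/-- The `N - m` remaining coordinates are counted with value 1 rather than 0, so the bound tends to
1 as `t T` approaches `t₀`. -/
theorem run_exp_kthLargest_le {N T : ℕ} {t₀ : ℝ} {ℓ p : ℕ → Fin N → ℝ} {t : ℕ → ℝ}
    (ht₀ : 0 < t₀) (h : IsCPRun phiNH projNonneg t₀ T ℓ p t) {m : ℕ} (hm : 1 ≤ m) (hmN : m ≤ N)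
    (hR : 0 ≤ kthLargest (regretVec p ℓ T) m) :
    Real.exp (kthLargest (regretVec p ℓ T) m ^ 2 / (2 * t T))
      ≤ 1 + N / m * (Real.sqrt (t T / t₀) - 1) := by
  have htT : 0 < t T := ht₀.trans_le (run_time_ge h T le_rfl)
  have e0 := Real.sqrt_pos.2 htT
  have hcount := sum_ge_of_kthLargest hm hmN (regretVec p ℓ T)
    (g := fun z => Real.exp ((projNonneg z / Real.sqrt (t T)) ^ 2 / 2)) (c := 1)
    (fun z => Real.one_le_exp (by positivity)) (fun z hz => by
      have h1 : projNonneg (kthLargest (regretVec p ℓ T) m) ≤ projNonneg z :=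
        max_le_max_right 0 hz
      have h0 : 0 ≤ projNonneg (kthLargest (regretVec p ℓ T) m) := le_max_right _ _
      gcongr)
  have hsum := run_sum_exp ht₀ h le_rfl
  simp only [normRegret] at hsum
  rw [hsum] at hcount
  simp only [projNonneg, max_eq_left hR, div_sqrt_sq htT, div_div] at hcount
  rw [mul_comm (t T)] at hcount
  have hm' : (0 : ℝ) < m := by exact_mod_cast hm
  refine le_of_mul_le_mul_left ?_ hm'
  have e : (m : ℝ) * (1 + N / m * (Real.sqrt (t T / t₀) - 1))
      = m + N * (Real.sqrt (t T / t₀) - 1) := by field_simp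
  rw [e]
  linarith

theorem quantileRegret_le {N : ℕ} (hN : 2 ≤ N) {B : ℝ} (hB : 0 < B) {ℓ : ℕ → Fin N → ℝ}
    (hℓ : ∀ j i i', |ℓ j i - ℓ j i'| ≤ B) {T : ℕ} {p : ℕ → Fin N → ℝ} {t : ℕ → ℝ}
    (h : IsCPRun phiNH projNonneg (startTime N B) T ℓ p t) {ε : ℝ} (hε : 0 < ε) (hε1 : ε < 1) :
    quantileRegret ε (regretVec p ℓ T) ≤
      Real.sqrt ((startTime N B + 2 * cumSecondMoment phiNH projNonneg ℓ p t T) *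
        (Real.log (startTime N B + 2 * cumSecondMoment phiNH projNonneg ℓ p t T)
          + 2 * Real.log (1 / ε))) := by
  obtain ⟨hB1, hB2⟩ := startTime_bounds hN B
  have ht1 : 1 ≤ startTime N B := le_max_right _ _
  have hN' : (2 : ℝ) ≤ N := by exact_mod_cast hN
  obtain ⟨m, hm⟩ : ∃ m, m = max 1 ⌊(N : ℝ) * ε⌋₊ := ⟨_, rfl⟩
  have hm1 : 1 ≤ m := hm ▸ le_max_left _ _
  have hmN : m + 1 ≤ N := by
    have : ⌊(N : ℝ) * ε⌋₊ < N := (Nat.floor_lt (by positivity)).2 (by nlinarith)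
    omega
  have hmε : N * ε < m + 1 := by
    have h1 := Nat.lt_floor_add_one ((N : ℝ) * ε)
    have h2 : (⌊(N : ℝ) * ε⌋₊ : ℝ) ≤ m := by rw [hm]; exact_mod_cast le_max_right _ _
    linarith
  rw [quantileRegret, ← hm]
  have hu2 : N = 2 → t T / startTime N B ≤ 5 / 4 →
      (t T / startTime N B - 1) - 2 / 5 * (t T / startTime N B - 1) ^ 2
        ≤ cumSecondMoment phiNH projNonneg ℓ p t T / startTime N B := by
    intro h2
    subst h2
    exact run_moment_ge_two (by linarith) h hB hℓ hB1 hB2 T le_rfl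
  have hu1 := run_moment_ge (by linarith) h (by omega) hB hℓ hB1 hB2 T le_rfl
  have htT := run_time_ge h T le_rfl
  rcases le_total (kthLargest (regretVec p ℓ T) m) 0 with hR | hR
  · exact hR.trans (Real.sqrt_nonneg _)
  have hexp := run_exp_kthLargest_le (by linarith) h hm1 (by omega) hR
  generalize kthLargest (regretVec p ℓ T) m = R at *
  generalize cumSecondMoment phiNH projNonneg ℓ p t T = V at *
  generalize startTime N B = t₀ at *
  generalize t T = tT at *
  have ht₀ : 0 < t₀ := by linarith
  have htT0 : 0 < tT := by linarith
  have hr1 : 1 ≤ tT / t₀ := (one_le_div ht₀).2 htT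
  set s := Real.sqrt (tT / t₀) with hs
  have hs1 : 1 ≤ s := Real.one_le_sqrt.2 hr1
  have hs2 : s ^ 2 = tT / t₀ := Real.sq_sqrt (by linarith)
  obtain ⟨u, hu⟩ : ∃ u, u = 1 + 2 * (V / t₀) := ⟨_, rfl⟩
  have hut : t₀ + 2 * V = t₀ * u := by rw [hu]; field_simp
  have hus : 1 + 9 / 5 * (s ^ 2 - 1) ≤ u := by
    have : 9 / 10 * (tT / t₀ - 1) ≤ V / t₀ := by
      rw [le_div_iff₀ ht₀]
      have : 9 / 10 * (tT / t₀ - 1) * t₀ = 9 / 10 * (tT - t₀) := by field_simp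
      linarith
    rw [hs2, hu]; linarith
  have hlogX := log_quantile_bound hN hm1 hmN hs1 hus (fun h2 h3 => by
    have := hu2 h2 (by linarith)
    rw [hs2, hu]; linarith)
  have hu1' : 1 ≤ u := by nlinarith
  have hsu : s ^ 2 ≤ u := by nlinarith
  have hm' : (1 : ℝ) ≤ m := by exact_mod_cast hm1
  have hmN' : (m : ℝ) + 1 ≤ N := by exact_mod_cast hmN
  have hs0 : 0 ≤ s - 1 := by linarith
  have hY : 0 < 1 + N / m * (s - 1) := by positivity
  have hlogE0 : 0 ≤ Real.log (N / (m + 1)) :=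
    Real.log_nonneg ((one_le_div (by linarith)).2 hmN')
  have hlogE : Real.log (N / (m + 1)) ≤ Real.log (1 / ε) := by
    apply Real.log_le_log (by positivity)
    rw [div_le_div_iff₀ (by linarith) hε]
    linarith
  have hlogY : Real.log (1 + N / m * (s - 1))
      = Real.log ((m + 1) / N * (1 + N / m * (s - 1))) + Real.log (N / (m + 1)) := by
    rw [← Real.log_mul (by positivity) (by positivity)]
    congr 1
    field_simp
  have hR1 := (Real.le_log_iff_exp_le hY).2 hexp
  rw [div_le_iff₀ (by positivity), hlogY] at hR1
  have hR2 : R ^ 2 ≤ t₀ * (u * Real.log u + 2 * (u * Real.log (1 / ε))) := by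
    have htT' : tT = t₀ * s ^ 2 := by rw [hs2]; field_simp
    have h1 : s ^ 2 * Real.log (N / (m + 1)) ≤ u * Real.log (1 / ε) :=
      mul_le_mul hsu hlogE hlogE0 (by linarith)
    rw [htT'] at hR1
    have h2 := mul_le_mul_of_nonneg_left hlogX ht₀.le
    have h3 := mul_le_mul_of_nonneg_left h1 ht₀.le
    linarith
  apply Real.le_sqrt_of_sq_le
  rw [hut]
  refine hR2.trans ?_
  -- Here `t₀ ≥ 1` restores the scale inside the logarithm.
  have hlogu : Real.log u ≤ Real.log (t₀ * u) :=
    Real.log_le_log (by linarith) (le_mul_of_one_le_left (by linarith) ht1)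
  have h4 : t₀ * u * Real.log u ≤ t₀ * u * Real.log (t₀ * u) :=
    mul_le_mul_of_nonneg_left hlogu (by positivity)
  linarith

theorem regretVec_eq_zero_of_one {T : ℕ} {p ℓ : ℕ → Fin 1 → ℝ}
    (hp : ∀ j < T, p j ∈ stdSimplex ℝ (Fin 1)) : regretVec p ℓ T = 0 := by
  funext i
  refine Finset.sum_eq_zero fun j hj => ?_
  have h := (hp j (Finset.mem_range.1 hj)).2
  rw [Fin.sum_univ_one] at h
  rw [instRegret, Fin.sum_univ_one, h, one_mul, Subsingleton.elim i 0, sub_self]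

end

theorem theorem2 (N : ℕ) (hN : 1 ≤ N) (B : ℝ) (hB : 0 < B)
    (ℓ : ℕ → Fin N → ℝ) (hℓ : ∀ j i i', |ℓ j i - ℓ j i'| ≤ B) :
    (∃ (p : ℕ → Fin N → ℝ) (t : ℕ → ℝ),
      ∀ T : ℕ, IsCPRun phiNH projNonneg (startTime N B) T ℓ p t) ∧
    ∀ (T : ℕ), 1 ≤ T → ∀ (p : ℕ → Fin N → ℝ) (t : ℕ → ℝ),
      IsCPRun phiNH projNonneg (startTime N B) T ℓ p t →
      ∀ ε : ℝ, 0 < ε → ε < 1 →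
        quantileRegret ε (regretVec p ℓ T) ≤
          Real.sqrt ((startTime N B + 2 * cumSecondMoment phiNH projNonneg ℓ p t T) *
            (Real.log (startTime N B + 2 * cumSecondMoment phiNH projNonneg ℓ p t T)
              + 2 * Real.log (1 / ε))) := by
  refine ⟨exists_isCPRun hN (lt_of_lt_of_le one_pos (le_max_right _ _)) ℓ, ?_⟩
  intro T _ p t h ε hε hε1
  rcases hN.eq_or_lt with rfl | hN2
  -- With one expert `log N = 0`, so the start time gives no control of `B`; but the regret vanishes
  -- identically.
  · rw [regretVec_eq_zero_of_one h.prob, quantileRegret, kthLargest]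
    split_ifs <;> exact Real.sqrt_nonneg _
  · exact quantileRegret_le hN2 hB hℓ h hε hε1
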